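/- Let $d\in\{1,2,3\}$, $\mathbb T^d=(\mathbb R/2\pi\mathbb Z)^d$, and let $\|u\|_{H^2}^2=\sum_{\ell\le 2}\|D^\ell u\|_{L^2}^2=\sum_{n\in\mathbb Z^d}(1+|n|^2+|n|^4)|\hat u(n)|^2$ (with normalised Haar measure) be the norm of $H^2=H^2(\mathbb T^d)$, with values in $\mathbb C$ or $\mathbb C^2$. **Noise.** $W=\sum_{n\in\mathbb Z^d}W_n e^{in\cdot x}$ with independent complex Brownian motions $W_n$ whose real and imaginary parts are independent real Brownian motions; $\Phi$ is the operator $\Phi e^{in\cdot x}=\Phi_n e^{in\cdot x}$. For a step $[t_\ell,t_{\ell+1}]$ of length $t$, $t_\ell=t_0+\ell t$, put $\chi_\ell=t^{-1/2}(W(t_{\ell+1})-W(t_\ell))$, and let $\int_0^t s\,dW(s)$ and $\int_0^t(W(s)-W(0))\,ds$ be taken relative to the start of the step. A filter is a family, indexed by the step size $t>0$, of Fourier multipliers that are bounded on $L^2$ for each $t$ (for example $\Psi(it\nabla)$ with $\Psi(0)=1$, $\|\Psi(it\nabla) u\|\le\|u\|$, or $((e^{it\nabla}-1)/(it))^p$,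 where in this last formula $\nabla$ has the real symbol $n$). **Schemes** $u_{\ell+1}=S_t(u_\ell)$: (a) with $f_1(z)=(e^z-1)/z$, $f_1(0)=1$, and $\mathrm{Tr}((\Delta\Phi)^2)=\sum_n|\Phi_n|^2|n|^4<\infty$, $$u_{\ell+1}=e^{it\Delta}u_\ell-it\,e^{it\Delta}\big(u_\ell^2 f_1(i\theta\Delta)\bar u_\ell\big)-i\sqrt t\,e^{it\Delta}(u_\ell\Phi\chi_\ell)-\tfrac t2 e^{it\Delta}\big(u_\ell((\Phi\chi_\ell)^2-\mathrm{Tr}(\Phi^2))\big),$$ where $\mathrm{Tr}(\Phi^2)=\sum_n\Phi_n^2$ and $\theta=\theta(t)$ is any real number depending on $t$; in particular $\theta=-2t$; (b) with $\mathrm{Tr}((\Delta^2\Phi)^2)=\sum_n|\Phi_n|^2|n|^8<\infty$ and a filter $\Psi_1$ with $d$ components, $$\begin{aligned}u_{\ell+1}&=e^{it\Delta}u_\ell-it\,e^{it\Delta}(u_\ell^2\bar u_\ell)-i\sqrt t\,e^{it\Delta}(u_\ell\Phi\chi_\ell)+e^{it\Delta}\Big(u_\ell\int_0^t s\,\Delta\Phi\,dW(s)+2\Psi_1(it\nabla)u_\ell\cdot\int_0^t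 s\,\nabla\Phi\,dW(s)\Big)\\&\quad-\tfrac t2e^{it\Delta}\big(u_\ell((\Phi\chi_\ell)^2-1)\big)-(1+2i)t^{3/2}e^{it\Delta}(u_\ell^2\bar u_\ell\Phi\chi_\ell)+i\,e^{it\Delta}\Big(u_\ell\bar u_\ell^2\int_0^t\Phi(\bar W(s)-\bar W(0))\,ds\Big)\\&\quad+it^{3/2}e^{it\Delta}\Big(u_\ell\big(\tfrac16(\Phi\chi_\ell)^3-\tfrac12\mathrm{Tr}(\Phi D\chi_\ell\Phi^*)\big)\Big),\end{aligned}$$ where $D\chi_\ell$ is the diagonal operator (in the basis $e^{in\cdot x}$) whose entries are the Fourier coefficients of $\chi_\ell$; (c) the Manakov scheme for $\mathbb C^2$-valued $u$, with Pauli matrices $\sigma_n$, $C_\gamma=i+\frac{3\gamma}2$, $\gamma\in\mathbb R$, scalar filters $\Psi_1,\Psi_2$, and $\chi_{n,\ell}$ the normalised increments (over the steps) of three independent real Brownian motions, $$u_{\ell+1}=e^{it\Delta}u_\ell-it\,e^{it\Delta}(|u_\ell|^2u_\ell)-i\sqrt t\,C_\gamma\sum_{n=1}^3\sigma_ne^{it\Delta}(\Psi_1(it\nabla)u_\ell)\chi_{n,\ell}+\tfrac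 t2C_\gamma^2\sum_{n<m}\sigma_m\sigma_n e^{it\Delta}\Psi_2(it\nabla)u_\ell\big[\tfrac12(\chi_{n,\ell}^2-1)+\chi_{n,\ell}\chi_{m,\ell}\big].$$ **Proposition.** Each of the schemes (a), (b), (c) is stochastically numerically stable: for every finite interval $[t_0,T]$, $0\le t_0<T$, there is $C>0$ such that for all $\varepsilon>0$, all step sizes $t\in(0,C)$ and all $R\ge 0$, $$\sup_{n\,:\,t_0+nt\le T}\mathbb P\big(\|S_t^n(v_1)-S_t^n(v_2)\|_{H^2}\ge\varepsilon\big)\longrightarrow0\quad\text{as }\|v_1-v_2\|_{H^2}\to0,\ v_1,v_2\in B_R(H^2),$$ where $B_R(H^2)=\{w\in H^2:\|w\|_{H^2}<R\}$ and $S_t^n(v)$ is the $n$-th iterate started from $v$ at time $t_0$. -/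

import Mathlib

open MeasureTheory ProbabilityTheory Filter Topology Set
open scoped NNReal ENNReal ComplexConjugate

namespace LowRegScheme

noncomputable section

/-! ### Function spaces and Fourier multipliers on the torus -/

/-- The torus `𝕋^d = (ℝ/2πℤ)^d`.  A point `y` is represented by `x = y / 2π ∈ (ℝ/ℤ)^d`, so that
`UnitAddTorus.mFourier n` is the exponential `e_n(y) = e^{i n·y}`; with respect to `y` it satisfies
`∂_j e_n = i n_j e_n` and `Δ e_n = -|n|² e_n`. -/
abbrev Torus (d : ℕ) : Type := UnitAddTorus (Fin d)

/-- The Fourier modes `ℤ^d`. -/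
abbrev Mode (d : ℕ) : Type := Fin d → ℤ

/-- The normalised Haar measure on the torus. -/
abbrev torusMeasure (d : ℕ) : Measure (Torus d) :=
  Measure.pi fun _ => (AddCircle.haarAddCircle : Measure UnitAddCircle)

variable {d : ℕ} {E : Type*} [NormedAddCommGroup E] [NormedSpace ℂ E]

/-- `|n|²` for a Fourier mode `n ∈ ℤ^d`. -/
def freqSq (n : Mode d) : ℝ := ∑ j, (n j : ℝ) ^ 2

/-- The Sobolev norm `(∑_{ℓ ≤ k} ‖D^ℓ u‖²_{L²})^{1/2}` of `H^k(𝕋^d; E)`, computed by Plancherel: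
`‖D^ℓ u‖²_{L²} = ∑_n |n|^{2ℓ} ‖û(n)‖²`. -/
def sobolevNorm (k : ℕ) (u : Torus d → E) : ℝ≥0∞ :=
  (∑' n : Mode d, ENNReal.ofReal (∑ ℓ ∈ Finset.range (k + 1), freqSq n ^ ℓ)
    * ‖UnitAddTorus.mFourierCoeff u n‖ₑ ^ 2) ^ (1 / 2 : ℝ)

/-- The open ball `B_R(H^k) = {w ∈ H^k : ‖w‖ < R}`, as a set of square-integrable functions. -/
def sobolevBall (d : ℕ) (E : Type*) [NormedAddCommGroup E] [NormedSpace ℂ E] (k : ℕ) (R : ℝ≥0) :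
    Set (Torus d → E) :=
  {w | MemLp w 2 (torusMeasure d) ∧ sobolevNorm k w < R}

/-- The Fourier multiplier with symbol `m`, i.e. `u ↦ ∑_n m(n) û(n) e_n`. -/
def fourierMul (m : Mode d → ℂ) (u : Torus d → E) : Torus d → E :=
  fun x => ∑' n : Mode d, (m n * UnitAddTorus.mFourier n x) • UnitAddTorus.mFourierCoeff u n

/-- The Schrödinger group `e^{itΔ}`. -/
def schrodingerGroup (t : ℝ) (u : Torus d → E) : Torus d → E :=
  fourierMul (fun n => Complex.exp (-(Complex.I * t * freqSq n))) u

/-- The scalar field `∑_n c(n) e_n` with Fourier coefficients `c`. -/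
def field (c : Mode d → ℂ) : Torus d → ℂ :=
  fun x => ∑' n : Mode d, c n * UnitAddTorus.mFourier n x

/-- The entire function `f₁(z) = (e^z - 1) / z`, `f₁(0) = 1`. -/
def f₁ (z : ℂ) : ℂ := if z = 0 then 1 else (Complex.exp z - 1) / z

/-- A filter: a family, indexed by the step size `t > 0`, of Fourier multipliers with symbols
`ψ t : ℤ^d → ℂ`, each of which is a bounded operator.  The normalised filters `Ψ(it∇)` with
`Ψ(0) = 1` and `‖Ψ(it∇)u‖ ≤ ‖u‖` are of this kind, and so are the filters `((e^{it∇} - 1)/(it))^p`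
(real frequencies `∇ ↦ n`), which replace `∇^p` and whose norm is at most `(2/t)^p`. -/
def IsFilter (ψ : ℝ≥0 → Mode d → ℂ) : Prop :=
  ∀ t : ℝ≥0, 0 < t → ∃ B : ℝ, ∀ n, ‖ψ t n‖ ≤ B

/-! ### The noise -/

variable {Ω : Type*} [MeasurableSpace Ω]

/-- The coefficients of the cylindrical Wiener process `W(t,x) = ∑_n W_n(t) e^{in·x}`: independent
complex Brownian motions, whose real and imaginary parts are independent real Brownian motions. -/
structure IsCylindricalWiener (W : Mode d → ℝ≥0 → Ω → ℂ) (P : Measure Ω) : Prop where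
  re_brownian : ∀ n, IsBrownianReal (fun t ω => (W n t ω).re) P
  im_brownian : ∀ n, IsBrownianReal (fun t ω => (W n t ω).im) P
  indep_re_im : ∀ n, IndepFun (fun ω t => (W n t ω).re) (fun ω t => (W n t ω).im) P
  indep_modes : iIndepFun (fun n ω t => W n t ω) P

/-- The normalised increment `χ = (w(a+t) - w(a)) / √t` over the step `[a, a+t]`. -/
def normIncr {F : Type*} [AddCommGroup F] [Module ℝ F] (w : ℝ≥0 → F) (a t : ℝ≥0) : F :=
  (√(t : ℝ))⁻¹ • (w (a + t) - w a)

/-- `∫_0^t (w(a+s) - w(a)) ds`. -/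
def timeIntegral (w : ℝ≥0 → ℂ) (a t : ℝ≥0) : ℂ :=
  ∫ s in (0 : ℝ)..t, (w (a + s.toNNReal) - w a)

/-- The Wiener integral `∫_0^t s dw(a+s)` over the step `[a, a+t]`, defined pathwise through
integration by parts.  For continuous paths it is the limit of the left-point (Itô) sums, see
`tendsto_leftSum_wienerIntegral`. -/
def wienerIntegral (w : ℝ≥0 → ℂ) (a t : ℝ≥0) : ℂ :=
  t * (w (a + t) - w a) - timeIntegral w a t

/-- The right Riemann sums of a continuous function converge to its integral. -/
theorem tendsto_rightSum {g : ℝ → ℂ} (hg : Continuous g) (t : ℝ) (ht : 0 ≤ t) :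
    Tendsto (fun N : ℕ => ∑ i ∈ Finset.range N, ((t / N : ℝ) : ℂ) * g ((i + 1 : ℕ) * (t / N)))
      atTop (𝓝 (∫ s in (0 : ℝ)..t, g s)) := by
  have huc : UniformContinuousOn g (Icc 0 t) :=
    isCompact_Icc.uniformContinuousOn_of_continuous hg.continuousOn
  rw [Metric.tendsto_atTop]
  intro ε hε
  obtain ⟨δ, hδ, hd⟩ := Metric.uniformContinuousOn_iff.1 huc (ε / (t + 1)) (by positivity)
  obtain ⟨M, hM⟩ := exists_nat_gt (t / δ)
  refine ⟨M + 1, fun N hN => ?_⟩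
  have hN0 : (0 : ℝ) < N := by
    have : 1 ≤ N := le_trans (Nat.le_add_left 1 M) hN
    exact_mod_cast this
  set h : ℝ := t / N with hh
  have h0 : 0 ≤ h := by positivity
  have hNh : (N : ℝ) * h = t := by rw [hh]; field_simp
  have hhδ : h < δ := by
    have hMN : (M : ℝ) < N := by exact_mod_cast hN
    rw [hh, div_lt_iff₀ hN0]
    have : t < M * δ := (div_lt_iff₀ hδ).1 hM
    nlinarith
  have hsplit : ∫ s in (0 : ℝ)..t, g s
      = ∑ i ∈ Finset.range N, ∫ s in ((i : ℕ) * h)..((i + 1 : ℕ) * h), g s := by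
    rw [intervalIntegral.sum_integral_adjacent_intervals (a := fun i : ℕ => (i : ℝ) * h)
      (fun k _ => hg.intervalIntegrable _ _)]
    simp [hNh]
  have hterm : ∀ i ∈ Finset.range N,
      ‖(h : ℂ) * g ((i + 1 : ℕ) * h) - ∫ s in ((i : ℕ) * h)..((i + 1 : ℕ) * h), g s‖
        ≤ ε / (t + 1) * h := by
    intro i hi
    have hiN : ((i + 1 : ℕ) : ℝ) ≤ N := by exact_mod_cast Finset.mem_range.1 hi
    have hlen : ((i + 1 : ℕ) : ℝ) * h - (i : ℕ) * h = h := by push_cast; ring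
    have hc : (h : ℂ) * g ((i + 1 : ℕ) * h)
        = ∫ _s in ((i : ℕ) * h)..((i + 1 : ℕ) * h), g ((i + 1 : ℕ) * h) := by
      rw [intervalIntegral.integral_const, hlen, Complex.real_smul]
    rw [hc, ← intervalIntegral.integral_sub (by simp) (hg.intervalIntegrable _ _)]
    refine (intervalIntegral.norm_integral_le_of_norm_le_const
      (C := ε / (t + 1)) fun s hs => ?_).trans ?_
    · rw [uIoc_of_le (by push_cast; nlinarith)] at hs
      have hi0 : (0 : ℝ) ≤ (i : ℝ) * h := by positivity
      have hup : ((i + 1 : ℕ) : ℝ) * h ≤ t := by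
        rw [← hNh]; exact mul_le_mul_of_nonneg_right hiN h0
      have := hd ((i + 1 : ℕ) * h) ⟨by positivity, hup⟩ s
        ⟨hi0.trans hs.1.le, hs.2.trans hup⟩ (by
          rw [Real.dist_eq, abs_of_nonneg (by linarith [hs.2])]
          linarith [hs.1, hlen])
      rw [dist_eq_norm] at this
      exact this.le
    · rw [hlen, abs_of_nonneg h0]
  rw [dist_eq_norm, hsplit, ← Finset.sum_sub_distrib]
  refine (norm_sum_le _ _).trans_lt ((Finset.sum_le_sum hterm).trans_lt ?_)
  rw [Finset.sum_const, Finset.card_range, nsmul_eq_mul]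
  have : (N : ℝ) * (ε / (t + 1) * h) = ε * (t / (t + 1)) := by rw [← hNh]; ring
  rw [this]
  have : t / (t + 1) < 1 := by rw [div_lt_one (by linarith)]; linarith
  nlinarith

/-- For a continuous path, `wienerIntegral` is the limit of the left-point sums
`∑ sᵢ (w(a + sᵢ₊₁) - w(a + sᵢ))`, `sᵢ = it/N`. -/
theorem tendsto_leftSum_wienerIntegral {w : ℝ≥0 → ℂ} (hw : Continuous w) (a t : ℝ≥0) :
    Tendsto (fun N : ℕ => ∑ i ∈ Finset.range N, ((i * (t / N) : ℝ) : ℂ) *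
        (w (a + (i + 1 : ℕ) * (t / N)) - w (a + i * (t / N))))
      atTop (𝓝 (wienerIntegral w a t)) := by
  have hg : Continuous fun s : ℝ => w (a + s.toNNReal) - w a := by fun_prop
  have hlim := (tendsto_rightSum hg t t.2).const_sub ((t : ℂ) * (w (a + t) - w a))
  refine hlim.congr' ?_
  filter_upwards [eventually_ge_atTop 1] with N hN
  have hN0 : (N : ℂ) ≠ 0 := by exact_mod_cast (by omega : N ≠ 0)
  have hN0' : (N : ℝ≥0) ≠ 0 := by exact_mod_cast (by omega : N ≠ 0)
  have hcast : ∀ i : ℕ, ((i : ℝ) * ((t : ℝ) / N)).toNNReal = (i : ℝ≥0) * (t / N) := by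
    intro i
    have : (i : ℝ) * ((t : ℝ) / N) = (((i : ℝ≥0) * (t / N) : ℝ≥0) : ℝ) := by push_cast; rfl
    rw [this, Real.toNNReal_coe]
  have habel : ∀ (x : ℕ → ℂ) (M : ℕ), ∑ i ∈ Finset.range M, (i : ℂ) * (x (i + 1) - x i)
      = M * x M - ∑ i ∈ Finset.range M, x (i + 1) := by
    intro x M
    induction M with
    | zero => simp
    | succ M ih => rw [Finset.sum_range_succ, Finset.sum_range_succ, ih]; push_cast; ring
  have key := habel (fun i => w (a + i * (t / N)) - w a) N
  simp only [hcast]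
  have hNt : (N : ℝ≥0) * (t / N) = t := by field_simp
  rw [hNt] at key
  have hL : ∑ i ∈ Finset.range N, ((i * (t / N) : ℝ) : ℂ) *
        (w (a + (i + 1 : ℕ) * (t / N)) - w (a + i * (t / N)))
      = ((t : ℂ) / N) * ∑ i ∈ Finset.range N, (i : ℂ) *
        ((w (a + (i + 1 : ℕ) * (t / N)) - w a) - (w (a + i * (t / N)) - w a)) := by
    rw [Finset.mul_sum]
    refine Finset.sum_congr rfl fun i _ => ?_
    push_cast
    ring
  have hc : (((t : ℝ) / N : ℝ) : ℂ) = (t : ℂ) / N := by push_cast; rfl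
  have hcancel : (t : ℂ) / N * (N * (w (a + t) - w a)) = t * (w (a + t) - w a) := by
    field_simp
  rw [hL, key, ← Finset.mul_sum, hc, mul_sub ((t : ℂ) / N), hcancel]

/-! ### The schemes

`S_t` denotes one step of length `t`; the arguments `χ`, `J`, `K` are the Fourier coefficients of
the noise terms of that step. -/

/-- The first scheme for the stochastic nonlinear Schrödinger equation,
`e^{itΔ}u - it e^{itΔ}(u² f₁(iθΔ)ū) - i√t e^{itΔ}(u Φχ) - (t/2) e^{itΔ}(u((Φχ)² - Tr Φ²))`.
Here `Φ e_n = Φ_n e_n`. -/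
def nlsStepHalf (Φ : Mode d → ℂ) (θ : ℝ) (t : ℝ≥0) (χ : Mode d → ℂ) (u : Torus d → ℂ) :
    Torus d → ℂ :=
  schrodingerGroup t u
    - (Complex.I * t) • schrodingerGroup t (fun x =>
        u x ^ 2 * fourierMul (fun n => f₁ (Complex.I * θ * (-freqSq n : ℝ)))
          (fun y => conj (u y)) x)
    - (Complex.I * √(t : ℝ)) • schrodingerGroup t (fun x => u x * field (fun n => Φ n * χ n) x)
    - ((t : ℂ) / 2) • schrodingerGroup t (fun x =>
        u x * (field (fun n => Φ n * χ n) x ^ 2 - ∑' n, Φ n ^ 2))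

/-- The second scheme for the stochastic nonlinear Schrödinger equation,
`e^{itΔ}u - it e^{itΔ}(u²ū) - i√t e^{itΔ}(u Φχ)`
`+ e^{itΔ}(u ∫ s ΔΦ dW + 2 Ψ₁(it∇)u · ∫ s ∇Φ dW) - (t/2) e^{itΔ}(u((Φχ)² - 1))`
`- (1+2i) t^{3/2} e^{itΔ}(u²ū Φχ) + i e^{itΔ}(u ū² ∫ Φ(W̄(s) - W̄(0)) ds)`
`+ i t^{3/2} e^{itΔ}(u((Φχ)³/6 - Tr(Φ Dχ Φ^*)/2))`.
`ψ j` is the symbol of the `j`-th component of the filter `Ψ₁(it∇)`; `χ`, `J`, `K` are the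
coefficients of `χ`, `∫ s dW(s)` and `∫ (W(s) - W(0)) ds`; the conjugate field
`∫ (W̄(s) - W̄(0)) ds` has coefficients `conj (K (-n))`; `Dχ` is the diagonal operator with entries
`χ n`. -/
def nlsStepOne (Φ : Mode d → ℂ) (ψ : Fin d → Mode d → ℂ) (t : ℝ≥0) (χ J K : Mode d → ℂ)
    (u : Torus d → ℂ) : Torus d → ℂ :=
  schrodingerGroup t u
    - (Complex.I * t) • schrodingerGroup t (fun x => u x ^ 2 * conj (u x))
    - (Complex.I * √(t : ℝ)) • schrodingerGroup t (fun x => u x * field (fun n => Φ n * χ n) x)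
    + schrodingerGroup t (fun x =>
        u x * field (fun n => (-freqSq n : ℝ) * Φ n * J n) x
          + 2 * ∑ j, fourierMul (ψ j) u x * field (fun n => Complex.I * (n j : ℂ) * Φ n * J n) x)
    - ((t : ℂ) / 2) • schrodingerGroup t (fun x =>
        u x * (field (fun n => Φ n * χ n) x ^ 2 - 1))
    - ((1 + 2 * Complex.I) * ((t : ℝ) ^ (3 / 2 : ℝ) : ℝ)) • schrodingerGroup t (fun x =>
        u x ^ 2 * conj (u x) * field (fun n => Φ n * χ n) x)
    + Complex.I • schrodingerGroup t (fun x =>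
        u x * conj (u x) ^ 2 * field (fun n => Φ n * conj (K (-n))) x)
    + (Complex.I * ((t : ℝ) ^ (3 / 2 : ℝ) : ℝ)) • schrodingerGroup t (fun x =>
        u x * (1 / 6 * field (fun n => Φ n * χ n) x ^ 3 - 1 / 2 * ∑' n, Φ n * χ n * conj (Φ n)))

/-- The Pauli matrices `σ₁, σ₂, σ₃`. -/
def pauli : Fin 3 → Matrix (Fin 2) (Fin 2) ℂ :=
  ![!![0, 1; 1, 0], !![0, -Complex.I; Complex.I, 0], !![1, 0; 0, -1]]

/-- The Manakov state space `ℂ²` with its Euclidean norm. -/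
abbrev C2 : Type := EuclideanSpace ℂ (Fin 2)

/-- Pointwise action of a matrix on a `ℂ²`-valued function. -/
def matAct (A : Matrix (Fin 2) (Fin 2) ℂ) (u : Torus d → C2) : Torus d → C2 :=
  fun x => WithLp.toLp 2 (A.mulVec (u x).ofLp)

/-- The constant `C_γ = i + 3γ/2`. -/
def manakovConst (γ : ℝ) : ℂ := Complex.I + 3 * γ / 2

/-- The scheme for the Manakov system,
`e^{itΔ}u - it e^{itΔ}(|u|²u) - i√t C_γ ∑_n σ_n e^{itΔ}(Ψ₁(it∇)u) χ_n`
`+ (t/2) C_γ² ∑_{n<m} σ_m σ_n e^{itΔ} Ψ₂(it∇)u [(χ_n² - 1)/2 + χ_n χ_m]`, with `C_γ = i + 3γ/2`. -/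
def manakovStep (γ : ℝ) (ψ₁ ψ₂ : Mode d → ℂ) (t : ℝ≥0) (χ : Fin 3 → ℝ) (u : Torus d → C2) :
    Torus d → C2 :=
  schrodingerGroup t u
    - (Complex.I * t) • schrodingerGroup t (fun x => ((‖u x‖ : ℂ) ^ 2) • u x)
    - (Complex.I * √(t : ℝ) * manakovConst γ) • ∑ n : Fin 3,
        (χ n : ℂ) • matAct (pauli n) (schrodingerGroup t (fourierMul ψ₁ u))
    + ((t : ℂ) / 2 * manakovConst γ ^ 2) • ∑ n : Fin 3, ∑ m : Fin 3, if n < m then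
        ((1 / 2 * (χ n ^ 2 - 1) + χ n * χ m : ℝ) : ℂ) •
          matAct (pauli m * pauli n) (schrodingerGroup t (fourierMul ψ₂ u)) else 0

/-! ### Random schemes, their iterates and stability -/

/-- A random one-step scheme: `S t₀ t ℓ ω u` is the step of length `t` from `t₀ + ℓt` to
`t₀ + (ℓ+1)t`, for the noise realisation `ω`, applied to `u`. -/
abbrev RandomScheme (Ω : Type*) (d : ℕ) (E : Type*) :=
  ℝ≥0 → ℝ≥0 → ℕ → Ω → (Torus d → E) → (Torus d → E)

/-- The numerical solution `S_t^n(v)` after `n` steps of length `t` started from `v` at `t₀`. -/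
def RandomScheme.iter {Ω : Type*} {E : Type*} (S : RandomScheme Ω d E) (t₀ t : ℝ≥0) (ω : Ω)
    (v : Torus d → E) : ℕ → Torus d → E
  | 0 => v
  | ℓ + 1 => S t₀ t ℓ ω (S.iter t₀ t ω v ℓ)

/-- Stochastic numerical stability in `H^k`: for every finite interval `[t₀, T]` there is `C > 0`
such that for all `ε > 0`, all step sizes `t ∈ (0, C)` and all radii `R`,
`lim sup_{n : t₀ + nt ≤ T} P(‖S_t^n(v₁) - S_t^n(v₂)‖_{H^k} ≥ ε) = 0` as `‖v₁ - v₂‖_{H^k} → 0` with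
`v₁, v₂ ∈ B_R(H^k)`. -/
def IsStochasticallyStable (k : ℕ) (P : Measure Ω) (S : RandomScheme Ω d E) : Prop :=
  ∀ t₀ T : ℝ≥0, t₀ < T → ∃ C : ℝ≥0, 0 < C ∧ ∀ ε : ℝ≥0, 0 < ε → ∀ t : ℝ≥0, 0 < t → t < C →
    ∀ R : ℝ≥0,
      Tendsto
        (fun v : (Torus d → E) × (Torus d → E) =>
          ⨆ n : ℕ, ⨆ _ : t₀ + n * t ≤ T,
            P {ω | (ε : ℝ≥0∞) ≤ sobolevNorm k (S.iter t₀ t ω v.1 n - S.iter t₀ t ω v.2 n)})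
        (comap (fun v => sobolevNorm k (v.1 - v.2)) (𝓝 0)
          ⊓ 𝓟 (sobolevBall d E k R ×ˢ sobolevBall d E k R))
        (𝓝 0)

/-- The first Schrödinger scheme, driven by the Wiener process `W`. -/
def nlsSchemeHalf (Φ : Mode d → ℂ) (θ : ℝ≥0 → ℝ) (W : Mode d → ℝ≥0 → Ω → ℂ) :
    RandomScheme Ω d ℂ :=
  fun t₀ t ℓ ω => nlsStepHalf Φ (θ t) t (fun n => normIncr (fun s => W n s ω) (t₀ + ℓ * t) t)

/-- The second Schrödinger scheme, driven by the Wiener process `W`. -/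
def nlsSchemeOne (Φ : Mode d → ℂ) (ψ : Fin d → ℝ≥0 → Mode d → ℂ) (W : Mode d → ℝ≥0 → Ω → ℂ) :
    RandomScheme Ω d ℂ :=
  fun t₀ t ℓ ω => nlsStepOne Φ (fun j => ψ j t) t
    (fun n => normIncr (fun s => W n s ω) (t₀ + ℓ * t) t)
    (fun n => wienerIntegral (fun s => W n s ω) (t₀ + ℓ * t) t)
    (fun n => timeIntegral (fun s => W n s ω) (t₀ + ℓ * t) t)

/-- The Manakov scheme, driven by three real Brownian motions `B`. -/
def manakovScheme (γ : ℝ) (ψ₁ ψ₂ : ℝ≥0 → Mode d → ℂ) (B : Fin 3 → ℝ≥0 → Ω → ℝ) :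
    RandomScheme Ω d C2 :=
  fun t₀ t ℓ ω => manakovStep γ (ψ₁ t) (ψ₂ t) t
    (fun n => normIncr (fun s => B n s ω) (t₀ + ℓ * t) t)

end

end LowRegScheme

open LowRegScheme

/-! For a fixed step size only finitely many steps fit into the interval, so it suffices to show
that each iterate is, off an event of small probability, Lipschitz on balls of `H²` with a
deterministic constant. No uniformity in `t` is needed: the Lipschitz constant may blow up as `t →
0`, and so may the norms of the filters.

For a fixed noise realisation, one step is a polynomial in `u`, its conjugate, filtered copies of
`u`, and noise fields, composed with the Schrödinger group. For `d ≤ 3` the space `H²` is an algebra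
(`sqWeightNorm_conv_le`, resting on `tsum_inv_weight_ne_top`), and conjugation and bounded Fourier
multipliers preserve it. Hence the step is locally Lipschitz on `H²`, with constants depending only
on bounds for the noise. The closure rules for `UnifLip` express this.

The noise enters through random fields whose squared `H²` norms have finite mean: the coefficients
have bounded second moments, and the trace condition on `Φ` sums them
(`BddSecondMoment.finiteMean_sqWeightNorm`). By Markov's inequality (`FiniteMean.exists_bound`) they
are bounded off an event of probability at most `η`. Composing finitely many steps with a union
bound (`exists_unifLip_iter`) gives the Lipschitz estimate for iterates, and
`isStochasticallyStable_of_unifLip` turns it into convergence in probability. -/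

namespace LowRegScheme

noncomputable section

variable {d : ℕ} {E F : Type*} [NormedAddCommGroup E] [NormedAddCommGroup F]

/-! ### Weighted sequences on the lattice -/

/-- The Cauchy-Schwarz inequality for sums in `[0, ∞]`, with a weight. -/
theorem tsum_sq_le_weighted {ι : Type*} (f p : ι → ℝ≥0∞) (h0 : ∀ i, p i ≠ 0) (h1 : ∀ i, p i ≠ ⊤) :
    (∑' i, f i) ^ 2 ≤ (∑' i, p i * f i ^ 2) * ∑' i, (p i)⁻¹ := by
  let : MeasurableSpace ι := ⊤
  have key := ENNReal.lintegral_mul_le_Lp_mul_Lq (μ := Measure.count)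
    Real.HolderConjugate.two_two (f := fun i => p i ^ (1 / 2 : ℝ) * f i)
    (g := fun i => (p i)⁻¹ ^ (1 / 2 : ℝ)) measurable_from_top.aemeasurable
    measurable_from_top.aemeasurable
  simp only [lintegral_count, Pi.mul_apply] at key
  have e1 : ∀ i, p i ^ (1 / 2 : ℝ) * f i * (p i)⁻¹ ^ (1 / 2 : ℝ) = f i := fun i => by
    rw [mul_right_comm, ← ENNReal.mul_rpow_of_nonneg _ _ (by norm_num),
      ENNReal.mul_inv_cancel (h0 i) (h1 i), ENNReal.one_rpow, one_mul]
  have e2 : ∀ i, (p i ^ (1 / 2 : ℝ) * f i) ^ (2 : ℝ) = p i * f i ^ 2 := fun i => by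
    rw [ENNReal.mul_rpow_of_nonneg _ _ (by norm_num), ← ENNReal.rpow_mul]
    norm_num
  have e3 : ∀ i, ((p i)⁻¹ ^ (1 / 2 : ℝ)) ^ (2 : ℝ) = (p i)⁻¹ := fun i => by
    rw [← ENNReal.rpow_mul]; norm_num
  simp only [e1, e2, e3] at key
  calc (∑' i, f i) ^ 2 ≤ _ := pow_le_pow_left' key 2
    _ = _ := by
      rw [← ENNReal.mul_rpow_of_nonneg _ _ (by norm_num), ← ENNReal.rpow_natCast,
        ← ENNReal.rpow_mul]
      norm_num

theorem freqSq_nonneg (n : Mode d) : 0 ≤ freqSq n :=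
  Finset.sum_nonneg fun _ _ => sq_nonneg _

theorem freqSq_neg (n : Mode d) : freqSq (-n) = freqSq n := by simp [freqSq]

theorem freqSq_add_le (m n : Mode d) : freqSq (m + n) ≤ 2 * freqSq m + 2 * freqSq n := by
  simp only [freqSq, Finset.mul_sum, ← Finset.sum_add_distrib]
  refine Finset.sum_le_sum fun j _ => ?_
  push_cast [Pi.add_apply]
  nlinarith [sq_nonneg ((m j : ℝ) - n j)]

theorem sq_le_freqSq (n : Mode d) (j : Fin d) : (n j : ℝ) ^ 2 ≤ freqSq n :=
  Finset.single_le_sum (f := fun j => (n j : ℝ) ^ 2) (fun _ _ => sq_nonneg _) (Finset.mem_univ j)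

/-- The weight `(1 + |n|²)²` of `H²`. -/
def weight (n : Mode d) : ℝ≥0∞ := ENNReal.ofReal ((1 + freqSq n) ^ 2)

theorem weight_ne_zero (n : Mode d) : weight n ≠ 0 := by
  have := freqSq_nonneg n
  simp only [weight, ne_eq, ENNReal.ofReal_eq_zero, not_le]
  positivity

theorem weight_ne_top (n : Mode d) : weight n ≠ ⊤ := ENNReal.ofReal_ne_top

theorem weight_neg (n : Mode d) : weight (-n) = weight n := by rw [weight, freqSq_neg, weight]

theorem one_le_weight (n : Mode d) : 1 ≤ weight n := by
  have := freqSq_nonneg n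
  rw [weight, ENNReal.one_le_ofReal]
  nlinarith

/-- With `a = 1 + |m|²` and `b = 1 + |n|²`, one has `1 + |m + n|² ≤ 2(a + b)`, and `4(a + b)² ≤ 8(a²
+ b²)`. -/
theorem weight_add_le (m n : Mode d) : weight (m + n) ≤ 8 * (weight m + weight n) := by
  have h1 := freqSq_nonneg m
  have h2 := freqSq_nonneg n
  have h3 := freqSq_nonneg (m + n)
  have h4 := freqSq_add_le m n
  rw [weight, weight, weight, ← ENNReal.ofReal_add (by positivity) (by positivity),
    ← ENNReal.ofReal_ofNat, ← ENNReal.ofReal_mul (by norm_num)]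
  refine ENNReal.ofReal_le_ofReal ?_
  nlinarith [sq_nonneg (freqSq m - freqSq n)]

/-- This is the kernel estimate behind the algebra property: along `m + n = k` the right side is
summable with a bound independent of `k`. -/
theorem weight_mul_inv_le (m n : Mode d) :
    weight (m + n) * (weight m * weight n)⁻¹ ≤ 8 * ((weight m)⁻¹ + (weight n)⁻¹) := by
  rw [ENNReal.mul_inv (.inl (weight_ne_zero m)) (.inl (weight_ne_top m))]
  calc _ ≤ 8 * (weight m + weight n) * ((weight m)⁻¹ * (weight n)⁻¹) :=
        mul_le_mul_left (weight_add_le m n) _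
    _ = 8 * (weight m * (weight m)⁻¹ * (weight n)⁻¹
          + weight n * (weight n)⁻¹ * (weight m)⁻¹) := by ring
    _ = _ := by
      rw [ENNReal.mul_inv_cancel (weight_ne_zero m) (weight_ne_top m),
        ENNReal.mul_inv_cancel (weight_ne_zero n) (weight_ne_top n), one_mul, one_mul, add_comm]

/-- `∑_{n ∈ ℤ^d} (1 + |n|²)⁻² < ∞` for `d ≤ 3`. -/
theorem tsum_inv_weight_ne_top (hd : d ≤ 3) : ∑' n : Mode d, (weight n)⁻¹ ≠ ⊤ := by
  set b := Pi.basisFun ℝ (Fin d)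
  set L := Submodule.span ℤ (Set.range b)
  have hL : Module.finrank ℤ L = d := by
    rw [ZLattice.rank ℝ L]; simp
  -- The exponent `4` has to exceed the rank `d` of the lattice; this is where `d ≤ 3` enters.
  have hs := ZLattice.summable_norm_pow_inv L 4 (by omega)
  have hmem : ∀ n : Mode d, (fun j => (n j : ℝ)) ∈ L := fun n => by
    rw [b.mem_span_iff_repr_mem ℤ]
    intro i
    exact ⟨n i, by simp [b]⟩
  have hinj : Function.Injective fun n : Mode d => (⟨fun j => (n j : ℝ), hmem n⟩ : L) := by
    intro m n h
    ext j
    have h' : (m j : ℝ) = n j := congrFun (congrArg Subtype.val h) j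
    exact_mod_cast h'
  have hs2 := hs.comp_injective hinj
  -- In the lattice series the zero mode contributes `0⁻¹ ^ 4 = 0`, so the value `1` of the inverse
  -- weight there is supplied separately.
  have hs3 : Summable fun n : Mode d => if n = 0 then (1 : ℝ) else 0 :=
    summable_of_ne_finset_zero (s := {0}) fun n hn => by simpa using hn
  have hs4 : Summable fun n : Mode d => ((1 + freqSq n) ^ 2)⁻¹ := by
    refine Summable.of_nonneg_of_le (fun n => by positivity) (fun n => ?_) (hs2.add hs3)
    have h0 := freqSq_nonneg n
    by_cases hn : n = 0
    · subst hn
      have : (0 : ℝ) ≤ ((fun z : L => ‖z‖⁻¹ ^ 4) ∘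
        fun n : Mode d => (⟨fun j => (n j : ℝ), hmem n⟩ : L)) 0 := by
        simp only [Function.comp]; positivity
      have h1 : ((1 + freqSq (0 : Mode d)) ^ 2)⁻¹ = 1 := by simp [freqSq]
      rw [h1]
      simp
    · simp only [Function.comp, hn, if_false, add_zero]
      set z : L := ⟨fun j => (n j : ℝ), hmem n⟩
      have hz : 0 < ‖z‖ := norm_pos_iff.2 fun h => hn (hinj (by
        change z = _; rw [h]; ext; simp))
      have hle : ‖z‖ ≤ √(freqSq n) := by
        change ‖(fun j => (n j : ℝ))‖ ≤ _
        refine (pi_norm_le_iff_of_nonneg (Real.sqrt_nonneg _)).2 fun j => ?_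
        exact Real.abs_le_sqrt (sq_le_freqSq n j)
      rw [inv_pow]
      refine inv_anti₀ (by positivity) ?_
      calc ‖z‖ ^ 4 ≤ √(freqSq n) ^ 4 := by gcongr
        _ = (√(freqSq n) ^ 2) ^ 2 := by ring
        _ = freqSq n ^ 2 := by rw [Real.sq_sqrt h0]
        _ ≤ _ := by gcongr; linarith
  have : ∀ n : Mode d, (weight n)⁻¹ = ENNReal.ofReal ((1 + freqSq n) ^ 2)⁻¹ := fun n => by
    have := freqSq_nonneg n
    rw [weight, ENNReal.ofReal_inv_of_pos (by positivity)]
  simp only [this]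
  exact hs4.tsum_ofReal_ne_top

/-- The squared `H²` norm of the function with Fourier coefficients `c`. -/
def sqWeightNorm (c : Mode d → E) : ℝ≥0∞ := ∑' n, weight n * ‖c n‖ₑ ^ 2

theorem sqWeightNorm_mono {c : Mode d → E} {b : Mode d → F} {B : ℝ≥0∞}
    (h : ∀ n, ‖c n‖ₑ ≤ B * ‖b n‖ₑ) : sqWeightNorm c ≤ B ^ 2 * sqWeightNorm b := by
  rw [sqWeightNorm, sqWeightNorm, ← ENNReal.tsum_mul_left]
  refine ENNReal.tsum_le_tsum fun n => ?_
  calc weight n * ‖c n‖ₑ ^ 2 ≤ weight n * (B * ‖b n‖ₑ) ^ 2 := by gcongr; exact h n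
    _ = _ := by ring

theorem sqWeightNorm_add_le (c b : Mode d → E) :
    sqWeightNorm (c + b) ≤ 2 * (sqWeightNorm c + sqWeightNorm b) := by
  rw [sqWeightNorm, sqWeightNorm, sqWeightNorm, ← ENNReal.tsum_add, ← ENNReal.tsum_mul_left]
  refine ENNReal.tsum_le_tsum fun n => ?_
  have h : ‖c n + b n‖ₑ ^ 2 ≤ 2 * (‖c n‖ₑ ^ 2 + ‖b n‖ₑ ^ 2) := by
    have h1 : ‖c n + b n‖ ^ 2 ≤ 2 * (‖c n‖ ^ 2 + ‖b n‖ ^ 2) := by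
      have := norm_add_le (c n) (b n)
      nlinarith [sq_nonneg (‖c n‖ - ‖b n‖), norm_nonneg (c n + b n)]
    simp only [← ofReal_norm, ← ENNReal.ofReal_pow (norm_nonneg _)]
    rw [← ENNReal.ofReal_add (by positivity) (by positivity), ← ENNReal.ofReal_ofNat,
      ← ENNReal.ofReal_mul (by norm_num)]
    exact ENNReal.ofReal_le_ofReal h1
  calc weight n * ‖(c + b) n‖ₑ ^ 2 ≤ weight n * (2 * (‖c n‖ₑ ^ 2 + ‖b n‖ₑ ^ 2)) := by
        gcongr; exact h
    _ = _ := by ring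

theorem sqWeightNorm_comp_neg (c : Mode d → E) :
    sqWeightNorm (fun n => c (-n)) = sqWeightNorm c := by
  rw [sqWeightNorm, sqWeightNorm, ← (Equiv.neg (Mode d)).tsum_eq]
  simp [weight_neg]

/-- Sobolev embedding into the Wiener algebra, by Cauchy-Schwarz against the summable inverse
weights. It makes every Fourier series of an `H²` function absolutely convergent. -/
theorem summable_norm_of_sqWeightNorm (hd : d ≤ 3) {c : Mode d → E} (h : sqWeightNorm c ≠ ⊤) :
    Summable fun n => ‖c n‖ := by
  have h1 := tsum_sq_le_weighted (fun n => ‖c n‖ₑ) weight weight_ne_zero weight_ne_top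
  have h2 : (∑' n, ‖c n‖ₑ) ^ 2 ≠ ⊤ :=
    ne_top_of_le_ne_top (ENNReal.mul_ne_top h (tsum_inv_weight_ne_top hd)) h1
  have h3 : ∑' n, ‖c n‖ₑ ≠ ⊤ := fun h => h2 (by simp [h])
  have := ENNReal.summable_toReal h3
  simpa using this

variable [NormedSpace ℂ E] [NormedSpace ℂ F]

/-- The Fourier coefficients of a product. -/
def conv (c : Mode d → ℂ) (b : Mode d → E) (k : Mode d) : E := ∑' n, c n • b (k - n)

/-- `H²(𝕋^d)` is an algebra for `d ≤ 3`. -/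
theorem sqWeightNorm_conv_le (c : Mode d → ℂ) (b : Mode d → E) :
    sqWeightNorm (conv c b)
      ≤ 16 * (∑' n : Mode d, (weight n)⁻¹) * (sqWeightNorm c * sqWeightNorm b) := by
  set S := ∑' n : Mode d, (weight n)⁻¹ with hS
  have hk : ∀ k, weight k * ‖conv c b k‖ₑ ^ 2 ≤ 16 * S *
      ∑' n, (weight n * ‖c n‖ₑ ^ 2) * (weight (k - n) * ‖b (k - n)‖ₑ ^ 2) := fun k => by
    have h1 : ‖conv c b k‖ₑ ≤ ∑' n, ‖c n‖ₑ * ‖b (k - n)‖ₑ := by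
      refine enorm_tsum_le_tsum_enorm.trans (le_of_eq (tsum_congr fun n => ?_))
      exact enorm_smul _ _
    have h2 := tsum_sq_le_weighted (fun n => ‖c n‖ₑ * ‖b (k - n)‖ₑ)
      (fun n => weight n * weight (k - n))
      (fun n => mul_ne_zero (weight_ne_zero _) (weight_ne_zero _))
      (fun n => ENNReal.mul_ne_top (weight_ne_top _) (weight_ne_top _))
    -- This bound is uniform in `k`: the two inverse weights have the same sum after the reflection
    -- `n ↦ k - n`, whence `16 = 8 · 2`.
    have h3 : weight k * ∑' n, (weight n * weight (k - n))⁻¹ ≤ 16 * S := by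
      rw [← ENNReal.tsum_mul_left]
      calc _ ≤ ∑' n, 8 * ((weight n)⁻¹ + (weight (k - n))⁻¹) := by
            refine ENNReal.tsum_le_tsum fun n => ?_
            have := weight_mul_inv_le n (k - n)
            rwa [add_sub_cancel] at this
        _ = 8 * (S + S) := by
            rw [ENNReal.tsum_mul_left, ENNReal.tsum_add]
            congr 2
            exact (Equiv.subLeft k).tsum_eq fun n => (weight n)⁻¹
        _ = 16 * S := by ring
    calc weight k * ‖conv c b k‖ₑ ^ 2
        ≤ weight k * ((∑' n, weight n * weight (k - n) * (‖c n‖ₑ * ‖b (k - n)‖ₑ) ^ 2)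
            * ∑' n, (weight n * weight (k - n))⁻¹) := by
          gcongr
          exact (pow_le_pow_left' h1 2).trans h2
      _ = (weight k * ∑' n, (weight n * weight (k - n))⁻¹)
            * ∑' n, weight n * weight (k - n) * (‖c n‖ₑ * ‖b (k - n)‖ₑ) ^ 2 := by ring
      _ ≤ 16 * S * ∑' n, weight n * weight (k - n) * (‖c n‖ₑ * ‖b (k - n)‖ₑ) ^ 2 := by gcongr
      _ = _ := by
          congr 1
          exact tsum_congr fun n => by ring
  calc sqWeightNorm (conv c b) ≤ ∑' k, 16 * S *
      ∑' n, (weight n * ‖c n‖ₑ ^ 2) * (weight (k - n) * ‖b (k - n)‖ₑ ^ 2) :=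
        ENNReal.tsum_le_tsum hk
    -- After Tonelli, translation invariance of the lattice sum factors the double sum into the
    -- product of the two norms.
    _ = 16 * S * ∑' n, ∑' k, (weight n * ‖c n‖ₑ ^ 2) * (weight (k - n) * ‖b (k - n)‖ₑ ^ 2) := by
        rw [ENNReal.tsum_mul_left, ENNReal.tsum_comm]
    _ = _ := by
        congr 1
        rw [sqWeightNorm, ← ENNReal.tsum_mul_right]
        refine tsum_congr fun n => ?_
        rw [ENNReal.tsum_mul_left]
        congr 1
        exact (Equiv.subRight n).tsum_eq fun m => weight m * ‖b m‖ₑ ^ 2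

/-! ### Absolutely convergent Fourier series -/

/-- The function with Fourier coefficients `c`. -/
def series (c : Mode d → E) : Torus d → E := fun x => ∑' n, UnitAddTorus.mFourier n x • c n

theorem norm_mFourier_apply (n : Mode d) (x : Torus d) : ‖UnitAddTorus.mFourier n x‖ = 1 := by
  simp only [UnitAddTorus.mFourier, fourier_apply, ContinuousMap.coe_mk, norm_prod,
    Circle.norm_coe, Finset.prod_const_one]

theorem summable_norm_series {c : Mode d → E} (hc : Summable fun n => ‖c n‖) (x : Torus d) :
    Summable fun n => ‖UnitAddTorus.mFourier n x • c n‖ := by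
  simpa only [norm_smul, norm_mFourier_apply, one_mul] using hc

theorem integral_mFourier_mul (n m : Mode d) :
    ∫ x, UnitAddTorus.mFourier (-n) x * UnitAddTorus.mFourier m x ∂(torusMeasure d)
      = if n = m then 1 else 0 := by
  have h := orthonormal_iff_ite.mp (UnitAddTorus.orthonormal_mFourier (d := Fin d)) n m
  simp only [ContinuousMap.inner_toLp, ← UnitAddTorus.mFourier_neg] at h
  rw [← h]
  exact integral_congr_ae (ae_of_all _ fun x => mul_comm _ _)

theorem mFourierCoeff_congr_ae {u v : Torus d → E} (h : u =ᵐ[torusMeasure d] v) :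
    UnitAddTorus.mFourierCoeff u = UnitAddTorus.mFourierCoeff v := by
  funext n
  refine integral_congr_ae (μ := torusMeasure d) ?_
  filter_upwards [h] with x hx
  rw [hx]

variable [CompleteSpace E]

theorem summable_series {c : Mode d → E} (hc : Summable fun n => ‖c n‖)
    (x : Torus d) : Summable fun n => UnitAddTorus.mFourier n x • c n :=
  (summable_norm_series hc x).of_norm

theorem continuous_series {c : Mode d → E} (hc : Summable fun n => ‖c n‖) :
    Continuous (series c) :=
  continuous_tsum (fun n => by fun_prop) hc fun n x => by
    rw [norm_smul, norm_mFourier_apply, one_mul]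

/-- The integrals of the norms of the terms are `‖c m‖`, which are summable, so integration is
termwise and orthonormality selects one term. -/
theorem mFourierCoeff_series {c : Mode d → E} (hc : Summable fun n => ‖c n‖) :
    UnitAddTorus.mFourierCoeff (series c) = c := by
  funext n
  have h1 : ∀ x : Torus d, UnitAddTorus.mFourier (-n) x • series c x
      = ∑' m, (UnitAddTorus.mFourier (-n) x * UnitAddTorus.mFourier m x) • c m := fun x => by
    simp only [mul_smul]
    exact ((summable_series hc x).tsum_const_smul _).symm
  have hcont : ∀ m, Continuous fun x : Torus d =>
      (UnitAddTorus.mFourier (-n) x * UnitAddTorus.mFourier m x) • c m := fun m => by fun_prop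
  have hnorm : ∀ m (x : Torus d),
      ‖(UnitAddTorus.mFourier (-n) x * UnitAddTorus.mFourier m x) • c m‖ = ‖c m‖ := fun m x => by
    rw [norm_smul, norm_mul, norm_mFourier_apply, norm_mFourier_apply, one_mul, one_mul]
  change ∫ x, UnitAddTorus.mFourier (-n) x • series c x ∂(torusMeasure d) = c n
  simp only [h1]
  rw [← integral_tsum_of_summable_integral_norm
    (fun m => (hcont m).integrable_of_hasCompactSupport (HasCompactSupport.of_compactSpace _))
    (by simpa only [hnorm, integral_const, probReal_univ, one_smul] using hc)]
  simp only [integral_smul_const, integral_mFourier_mul]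
  rw [tsum_eq_single n fun m hm => by simp [hm.symm]]
  simp

theorem series_add {c b : Mode d → E} (hc : Summable fun n => ‖c n‖)
    (hb : Summable fun n => ‖b n‖) : series (c + b) = series c + series b := by
  funext x
  simp only [series, Pi.add_apply, smul_add]
  exact (summable_series hc x).tsum_add (summable_series hb x)

theorem series_clm (A : E →L[ℂ] F) {c : Mode d → E} (hc : Summable fun n => ‖c n‖) (x : Torus d) :
    series (fun n => A (c n)) x = A (series c x) := by
  simp only [series]
  rw [A.map_tsum (summable_series hc x)]
  simp

theorem series_conj (c : Mode d → ℂ) (x : Torus d) :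
    series (fun n => conj (c (-n))) x = conj (series c x) := by
  simp only [series]
  rw [Complex.conj_tsum, ← (Equiv.neg (Mode d)).tsum_eq]
  refine tsum_congr fun n => ?_
  simp [UnitAddTorus.mFourier_neg]

/-- A Cauchy product: the double series converges absolutely, so it may be summed along the fibres
where the two frequencies add up to `k`. -/
theorem series_smul_series {c : Mode d → ℂ} {b : Mode d → E} (hc : Summable fun n => ‖c n‖)
    (hb : Summable fun n => ‖b n‖) (x : Torus d) :
    series c x • series b x = series (conv c b) x := by
  have hs : Summable fun p : Mode d × Mode d =>
      (UnitAddTorus.mFourier p.1 x • c p.1) • (UnitAddTorus.mFourier p.2 x • b p.2) := by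
    refine Summable.of_norm ?_
    simp only [norm_smul, norm_mFourier_apply, one_mul]
    exact hc.mul_of_nonneg hb (fun _ => norm_nonneg _) fun _ => norm_nonneg _
  have h1 := ((summable_series hc x).hasSum.smul (summable_series hb x).hasSum hs).tsum_eq
  let e : Mode d × Mode d ≃ Mode d × Mode d :=
    { toFun := fun p => (p.2, p.1 - p.2)
      invFun := fun p => (p.1 + p.2, p.1)
      left_inv := fun p => by simp
      right_inv := fun p => by simp }
  rw [← e.tsum_eq] at h1
  have hs' := (e.summable_iff).2 hs
  simp only [Function.comp_def] at hs'
  rw [Summable.tsum_prod hs'] at h1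
  refine h1.symm.trans (tsum_congr fun k => ?_)
  have hk : ∀ n, (UnitAddTorus.mFourier n x • c n) • (UnitAddTorus.mFourier (k - n) x • b (k - n))
      = UnitAddTorus.mFourier k x • (c n • b (k - n)) := fun n => by
    have := UnitAddTorus.mFourier_add (m := n) (n := k - n) (x := x)
    rw [add_sub_cancel] at this
    rw [this, smul_smul, smul_smul, smul_eq_mul]
    congr 1
    ring
  simp only [e, Equiv.coe_fn_mk, hk, conv]
  -- For fixed `k` this follows from summability of `c` and boundedness of `b`.
  have hsum : Summable fun n => c n • b (k - n) := by
    refine Summable.of_norm ?_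
    have h2 : Summable fun n => ‖c n‖ * ‖b (k - n)‖ := by
      obtain ⟨M, hM⟩ : ∃ M, ∀ n, ‖b n‖ ≤ M := by
        obtain ⟨M, hM⟩ := hb.tendsto_cofinite_zero.bddAbove_range_of_cofinite
        exact ⟨M, fun n => hM ⟨n, rfl⟩⟩
      exact Summable.of_nonneg_of_le (fun n => by positivity)
        (fun n => mul_le_mul_of_nonneg_left (hM _) (norm_nonneg _)) (hc.mul_right M)
    simpa only [norm_smul] using h2
  exact hsum.tsum_const_smul _

end

end LowRegScheme

namespace LowRegScheme

noncomputable section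

variable {d : ℕ} {E F : Type*} [NormedAddCommGroup E] [NormedAddCommGroup F]

theorem summable_norm_of_le (hd : d ≤ 3) {c : Mode d → E} {r : ℝ≥0} (h : sqWeightNorm c ≤ r) :
    Summable fun n => ‖c n‖ :=
  summable_norm_of_sqWeightNorm hd (ne_top_of_le_ne_top ENNReal.coe_ne_top h)

variable [NormedSpace ℂ E] [NormedSpace ℂ F]

/-! ### Functions of bounded `H²` norm -/

/-- The function `u` has squared `H²` norm at most `r`. -/
def SobolevBdd (u : Torus d → E) (r : ℝ≥0) : Prop :=
  ∃ c : Mode d → E, sqWeightNorm c ≤ r ∧ u =ᵐ[torusMeasure d] series c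

/-- The constant in the algebra property of `H²`. -/
def algConst (d : ℕ) : ℝ≥0 := (16 * ∑' n : Mode d, (weight n)⁻¹).toNNReal

theorem coe_algConst (hd : d ≤ 3) : (algConst d : ℝ≥0∞) = 16 * ∑' n : Mode d, (weight n)⁻¹ :=
  ENNReal.coe_toNNReal (ENNReal.mul_ne_top (by norm_num) (tsum_inv_weight_ne_top hd))

theorem SobolevBdd.mono {u : Torus d → E} {r s : ℝ≥0} (h : SobolevBdd u r) (hrs : r ≤ s) :
    SobolevBdd u s := by
  obtain ⟨c, hc, hu⟩ := h
  exact ⟨c, hc.trans (by exact_mod_cast hrs), hu⟩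

theorem SobolevBdd.clm [CompleteSpace E] (hd : d ≤ 3) (A : E →L[ℂ] F) {u : Torus d → E} {r : ℝ≥0}
    (h : SobolevBdd u r) : SobolevBdd (fun x => A (u x)) (‖A‖₊ ^ 2 * r) := by
  obtain ⟨c, hc, hu⟩ := h
  refine ⟨fun n => A (c n), ?_, ?_⟩
  · refine (sqWeightNorm_mono (B := ‖A‖₊) (b := c) fun n => ?_).trans ?_
    · exact A.le_opENorm (c n)
    · push_cast
      gcongr
  · filter_upwards [hu] with x hx
    rw [hx, series_clm A (summable_norm_of_le hd hc)]

theorem SobolevBdd.add [CompleteSpace E] (hd : d ≤ 3) {u v : Torus d → E} {r s : ℝ≥0}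
    (hu : SobolevBdd u r) (hv : SobolevBdd v s) : SobolevBdd (u + v) (2 * (r + s)) := by
  obtain ⟨c, hc, hu⟩ := hu
  obtain ⟨b, hb, hv⟩ := hv
  refine ⟨c + b, (sqWeightNorm_add_le c b).trans ?_, ?_⟩
  · push_cast
    gcongr
  · rw [series_add (summable_norm_of_le hd hc) (summable_norm_of_le hd hb)]
    exact hu.add hv

theorem SobolevBdd.neg {u : Torus d → E} {r : ℝ≥0} (h : SobolevBdd u r) : SobolevBdd (-u) r := by
  obtain ⟨c, hc, hu⟩ := h
  refine ⟨-c, ?_, ?_⟩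
  · simpa [sqWeightNorm] using hc
  · filter_upwards [hu] with x hx
    simp [hx, series, tsum_neg]

theorem SobolevBdd.sub [CompleteSpace E] (hd : d ≤ 3) {u v : Torus d → E} {r s : ℝ≥0}
    (hu : SobolevBdd u r) (hv : SobolevBdd v s) : SobolevBdd (u - v) (2 * (r + s)) := by
  rw [sub_eq_add_neg]
  exact hu.add hd hv.neg

theorem SobolevBdd.smul [CompleteSpace E] (hd : d ≤ 3) {u : Torus d → ℂ} {v : Torus d → E}
    {r s : ℝ≥0} (hu : SobolevBdd u r) (hv : SobolevBdd v s) :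
    SobolevBdd (fun x => u x • v x) (algConst d * (r * s)) := by
  obtain ⟨c, hc, hu⟩ := hu
  obtain ⟨b, hb, hv⟩ := hv
  refine ⟨conv c b, (sqWeightNorm_conv_le c b).trans ?_, ?_⟩
  · push_cast
    rw [coe_algConst hd]
    gcongr
  · filter_upwards [hu, hv] with x hx hx'
    rw [hx, hx', series_smul_series (summable_norm_of_le hd hc) (summable_norm_of_le hd hb)]

theorem SobolevBdd.conj {u : Torus d → ℂ} {r : ℝ≥0} (h : SobolevBdd u r) :
    SobolevBdd (fun x => conj (u x)) r := by
  obtain ⟨c, hc, hu⟩ := h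
  refine ⟨fun n => (starRingEnd ℂ) (c (-n)), ?_, ?_⟩
  · rw [sqWeightNorm_comp_neg (fun n => (starRingEnd ℂ) (c n))]
    refine le_of_eq_of_le ?_ hc
    exact tsum_congr fun n => by rw [RCLike.enorm_conj]
  · filter_upwards [hu] with x hx
    rw [hx, series_conj]

/-- The witness in `SobolevBdd` is forced to be the family of Fourier coefficients, so a multiplier,
defined through `mFourierCoeff`, acts on that witness. -/
theorem SobolevBdd.mFourierCoeff_eq [CompleteSpace E] (hd : d ≤ 3) {u : Torus d → E}
    {c : Mode d → E} {r : ℝ≥0} (hc : sqWeightNorm c ≤ r) (hu : u =ᵐ[torusMeasure d] series c) :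
    UnitAddTorus.mFourierCoeff u = c := by
  rw [mFourierCoeff_congr_ae hu, mFourierCoeff_series (summable_norm_of_le hd hc)]

theorem fourierMul_eq_series (m : Mode d → ℂ) (u : Torus d → E) :
    fourierMul m u = series (fun n => m n • UnitAddTorus.mFourierCoeff u n) := by
  funext x
  exact tsum_congr fun n => by rw [smul_smul, mul_comm]

theorem SobolevBdd.fourierMul [CompleteSpace E] (hd : d ≤ 3) {m : Mode d → ℂ} {B : ℝ≥0}
    (hm : ∀ n, ‖m n‖ ≤ B) {u : Torus d → E} {r : ℝ≥0} (h : SobolevBdd u r) :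
    SobolevBdd (fourierMul m u) (B ^ 2 * r) := by
  obtain ⟨c, hc, hu⟩ := h
  refine ⟨fun n => m n • c n, ?_, ?_⟩
  · refine (sqWeightNorm_mono (B := B) (b := c) fun n => ?_).trans ?_
    · rw [enorm_smul]
      gcongr
      rw [← ofReal_norm]
      exact (ENNReal.ofReal_le_ofReal (hm n)).trans (by simp)
    · push_cast
      gcongr
  · rw [fourierMul_eq_series, SobolevBdd.mFourierCoeff_eq hd hc hu]

/-- Linearity needs the `H²` bounds, because integrals and infinite sums take the default value `0`
when they do not converge. -/
theorem fourierMul_sub [CompleteSpace E] (hd : d ≤ 3) {m : Mode d → ℂ} {B : ℝ≥0}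
    (hm : ∀ n, ‖m n‖ ≤ B) {u v : Torus d → E} {r s : ℝ≥0} (hu : SobolevBdd u r)
    (hv : SobolevBdd v s) : fourierMul m (u - v) = fourierMul m u - fourierMul m v := by
  have huv := hu.sub hd hv
  obtain ⟨c, hc, hu⟩ := hu
  obtain ⟨b, hb, hv⟩ := hv
  have hsc := summable_norm_of_le hd hc
  have hsb := summable_norm_of_le hd hb
  have hcb : UnitAddTorus.mFourierCoeff (u - v) = c - b := by
    have h1 : u - v =ᵐ[torusMeasure d] series (c - b) := by
      filter_upwards [hu, hv] with x hx hx'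
      simp only [Pi.sub_apply, hx, hx', series, smul_sub]
      exact ((summable_series hsc x).tsum_sub (summable_series hsb x)).symm
    rw [mFourierCoeff_congr_ae h1, mFourierCoeff_series]
    exact Summable.of_nonneg_of_le (fun n => norm_nonneg _) (fun n => norm_sub_le _ _)
      (hsc.add hsb)
  have hmul : ∀ {a : Mode d → E}, (Summable fun n => ‖a n‖) → Summable fun n => ‖m n • a n‖ :=
    fun {a} ha => Summable.of_nonneg_of_le (fun n => norm_nonneg _) (fun n => by
      rw [norm_smul]; exact mul_le_mul_of_nonneg_right (hm n) (norm_nonneg _)) (ha.mul_left (B : ℝ))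
  funext x
  simp only [fourierMul_eq_series, hcb, SobolevBdd.mFourierCoeff_eq hd hc hu,
    SobolevBdd.mFourierCoeff_eq hd hb hv, Pi.sub_apply, series, smul_sub]
  exact (summable_series (hmul hsc) x).tsum_sub (summable_series (hmul hsb) x)

theorem SobolevBdd.const (a : E) : SobolevBdd (fun _ : Torus d => a) (‖a‖₊ ^ 2) := by
  classical
  refine ⟨Pi.single 0 a, ?_, ae_of_all _ fun x => ?_⟩
  · rw [sqWeightNorm, tsum_eq_single 0 fun n hn => by simp [hn]]
    simp [weight, freqSq, enorm_eq_nnnorm]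
  · rw [series, tsum_eq_single 0 fun n hn => by simp [hn]]
    simp [UnitAddTorus.mFourier_zero]

theorem SobolevBdd.field {c : Mode d → ℂ} {r : ℝ≥0} (h : sqWeightNorm c ≤ r) :
    SobolevBdd (field c) r :=
  ⟨c, h, ae_of_all _ fun x => tsum_congr fun n => by rw [smul_eq_mul, mul_comm]⟩

/-! ### Comparison with the Sobolev norm, and Fourier inversion -/

theorem sobolevNorm_sq (k : ℕ) (u : Torus d → E) :
    sobolevNorm k u ^ 2 = ∑' n : Mode d, ENNReal.ofReal (∑ ℓ ∈ Finset.range (k + 1), freqSq n ^ ℓ)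
      * ‖UnitAddTorus.mFourierCoeff u n‖ₑ ^ 2 := by
  rw [sobolevNorm, ← ENNReal.rpow_natCast, ← ENNReal.rpow_mul]
  norm_num

/-- The weights compare by `1 + x + x² ≤ (1 + x)²` with `x = |n|²`. -/
theorem SobolevBdd.sobolevNorm_sq_le [CompleteSpace E] (hd : d ≤ 3) {u : Torus d → E} {r : ℝ≥0}
    (h : SobolevBdd u r) : sobolevNorm 2 u ^ 2 ≤ r := by
  obtain ⟨c, hc, hu⟩ := h
  rw [sobolevNorm_sq, SobolevBdd.mFourierCoeff_eq hd hc hu]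
  refine le_trans (ENNReal.tsum_le_tsum fun n => ?_) hc
  have := freqSq_nonneg n
  refine mul_le_mul_left (ENNReal.ofReal_le_ofReal ?_) _
  simp only [Finset.sum_range_succ, Finset.sum_range_zero]
  nlinarith

/-- The reverse comparison of weights is `(1 + x)² ≤ 2(1 + x + x²)`. -/
theorem sqWeightNorm_mFourierCoeff_le (u : Torus d → E) :
    sqWeightNorm (UnitAddTorus.mFourierCoeff u) ≤ 2 * sobolevNorm 2 u ^ 2 := by
  rw [sobolevNorm_sq, sqWeightNorm, ← ENNReal.tsum_mul_left]
  refine ENNReal.tsum_le_tsum fun n => ?_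
  have := freqSq_nonneg n
  rw [← mul_assoc, ← ENNReal.ofReal_ofNat, ← ENNReal.ofReal_mul (by norm_num)]
  refine mul_le_mul_left (ENNReal.ofReal_le_ofReal ?_) _
  simp only [Finset.sum_range_succ, Finset.sum_range_zero]
  nlinarith [sq_nonneg (freqSq n)]

/-- A square-integrable function with values in `E` whose Fourier coefficients are absolutely
summable is almost everywhere the sum of its Fourier series. -/
def HasFourierInversion (d : ℕ) (E : Type*) [NormedAddCommGroup E] [NormedSpace ℂ E] : Prop :=
  ∀ v : Torus d → E, MemLp v 2 (torusMeasure d) →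
    (Summable fun n => ‖UnitAddTorus.mFourierCoeff v n‖) →
      v =ᵐ[torusMeasure d] series (UnitAddTorus.mFourierCoeff v)

theorem SobolevBdd.of_sobolevNorm (hE : HasFourierInversion d E) (hd : d ≤ 3) {v : Torus d → E}
    (hv : MemLp v 2 (torusMeasure d)) {r : ℝ≥0} (h : sobolevNorm 2 v ≤ r) :
    SobolevBdd v (2 * r ^ 2) := by
  have h1 : sqWeightNorm (UnitAddTorus.mFourierCoeff v) ≤ (2 * r ^ 2 : ℝ≥0) := by
    refine (sqWeightNorm_mFourierCoeff_le v).trans ?_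
    push_cast
    gcongr
  exact ⟨_, h1, hE v hv (summable_norm_of_le hd h1)⟩

/-- Both `v` and its continuous Fourier series lie in `L²` and have the same coordinates in the
Hilbert basis of exponentials, hence they define the same class. -/
theorem hasFourierInversion_complex : HasFourierInversion d ℂ := by
  intro v hv hs
  have hcont := continuous_series hs
  have hmem : MemLp (series (UnitAddTorus.mFourierCoeff v)) 2 (torusMeasure d) := by
    obtain ⟨M, hM⟩ := isCompact_univ.exists_bound_of_continuousOn hcont.continuousOn
    exact MemLp.of_bound hcont.aestronglyMeasurable M (ae_of_all _ fun x => hM x (mem_univ x))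
  have h1 : hv.toLp v = hmem.toLp _ := by
    refine UnitAddTorus.mFourierBasis.repr.injective ?_
    ext n
    refine (UnitAddTorus.mFourierBasis_repr _ n).trans
      (Eq.trans ?_ (UnitAddTorus.mFourierBasis_repr _ n).symm)
    rw [mFourierCoeff_congr_ae hv.coeFn_toLp, mFourierCoeff_congr_ae hmem.coeFn_toLp,
      mFourierCoeff_series hs]
  exact (MemLp.toLp_eq_toLp_iff hv hmem).1 h1

/-- Coordinate projections are continuous and linear, so they commute with the coefficient integrals
and with the series; the scalar case applies to each component. -/
theorem hasFourierInversion_C2 : HasFourierInversion d C2 := by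
  intro v hv hs
  have hint : ∀ n, Integrable (fun x => UnitAddTorus.mFourier (-n) x • v x) (torusMeasure d) :=
    fun n => by
      have hv1 : Integrable v (torusMeasure d) := hv.integrable (by norm_num)
      exact hv1.bdd_smul 1 (UnitAddTorus.mFourier (-n)).continuous.aestronglyMeasurable
        (ae_of_all _ fun x => (norm_mFourier_apply _ x).le)
  have hcoeff : ∀ (i : Fin 2) n, UnitAddTorus.mFourierCoeff (fun x => v x i) n
      = UnitAddTorus.mFourierCoeff v n i := fun i n =>
    (EuclideanSpace.proj (𝕜 := ℂ) i).integral_comp_comm (hint n)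
  have hle : ∀ (i : Fin 2) n, ‖UnitAddTorus.mFourierCoeff v n i‖
      ≤ ‖UnitAddTorus.mFourierCoeff v n‖ := fun i n => PiLp.norm_apply_le _ i
  have key : ∀ i : Fin 2, (fun x => v x i) =ᵐ[torusMeasure d]
      fun x => series (UnitAddTorus.mFourierCoeff v) x i := fun i => by
    have hm : MemLp (fun x => v x i) 2 (torusMeasure d) :=
      (EuclideanSpace.proj (𝕜 := ℂ) i).comp_memLp' hv
    have hs' : Summable fun n => ‖UnitAddTorus.mFourierCoeff (fun x => v x i) n‖ := by
      simp only [hcoeff]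
      exact Summable.of_nonneg_of_le (fun n => norm_nonneg _) (hle i) hs
    filter_upwards [hasFourierInversion_complex _ hm hs'] with x hx
    rw [hx]
    refine Eq.trans ?_ (series_clm (EuclideanSpace.proj (𝕜 := ℂ) i) hs x)
    congr 1
    funext n
    exact hcoeff i n
  filter_upwards [key 0, key 1] with x h0 h1
  ext i
  fin_cases i
  · exact h0
  · exact h1

end

end LowRegScheme

namespace LowRegScheme

noncomputable section

variable {d : ℕ} {E F H : Type*} [NormedAddCommGroup E] [NormedSpace ℂ E]
  [NormedAddCommGroup F] [NormedSpace ℂ F]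
  [NormedAddCommGroup H] [NormedSpace ℂ H]
  {Ω : Type*} {G : Set Ω}

/-- This is `|e^{iy} - 1| ≤ |y|`. The bound does not depend on `y`, which is why `θ` can be
arbitrary in the first scheme. -/
theorem norm_f₁_le_one (y : ℝ) : ‖f₁ (Complex.I * y)‖ ≤ 1 := by
  rw [f₁]
  split_ifs with h
  · simp
  · rw [norm_div]
    refine div_le_one_of_le₀ ?_ (norm_nonneg _)
    simpa using Real.norm_exp_I_mul_ofReal_sub_one_le (x := y)

/-! ### Random maps that are locally Lipschitz on `H²` -/

/-- The maps `f ω`, `ω ∈ G`, are bounded and Lipschitz on balls of `H²`, uniformly in `ω`. -/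
def UnifLip (G : Set Ω) (f : Ω → (Torus d → E) → (Torus d → F)) : Prop :=
  ∀ R : ℝ≥0, ∃ R' L : ℝ≥0, ∀ ω ∈ G, ∀ u, SobolevBdd u R → SobolevBdd (f ω u) R' ∧
    ∀ v δ, SobolevBdd v R → SobolevBdd (u - v) δ → SobolevBdd (f ω u - f ω v) (L * δ)

theorem UnifLip.mono {G' : Set Ω} {f : Ω → (Torus d → E) → (Torus d → F)} (hf : UnifLip G f)
    (h : G' ⊆ G) : UnifLip G' f := fun R => by
  obtain ⟨R', L, hL⟩ := hf R
  exact ⟨R', L, fun ω hω => hL ω (h hω)⟩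

theorem UnifLip.id : UnifLip G fun _ (u : Torus d → E) => u := fun R =>
  ⟨R, 1, fun _ _ _ hu => ⟨hu, fun _ _ _ h => by rwa [one_mul]⟩⟩

/-- The output radius of the inner map is the input radius of the outer one. Since `δ` ranges over
all bounds of the squared distance, the Lipschitz constants simply multiply. -/
theorem UnifLip.comp {f : Ω → (Torus d → E) → (Torus d → F)}
    {g : Ω → (Torus d → F) → (Torus d → H)} (hg : UnifLip G g) (hf : UnifLip G f) :
    UnifLip G fun ω u => g ω (f ω u) := fun R => by
  obtain ⟨R₁, L₁, h₁⟩ := hf R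
  obtain ⟨R₂, L₂, h₂⟩ := hg R₁
  refine ⟨R₂, L₂ * L₁, fun ω hω u hu => ⟨(h₂ ω hω _ (h₁ ω hω u hu).1).1, fun v δ hv huv => ?_⟩⟩
  rw [mul_assoc]
  exact (h₂ ω hω _ (h₁ ω hω u hu).1).2 _ _ (h₁ ω hω v hv).1 ((h₁ ω hω u hu).2 v δ hv huv)

theorem UnifLip.of_bdd {f : Ω → Torus d → F} {r : ℝ≥0} (h : ∀ ω ∈ G, SobolevBdd (f ω) r) :
    UnifLip G fun ω (_ : Torus d → E) => f ω := fun _ =>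
  ⟨r, 0, fun ω hω _ _ => ⟨h ω hω, fun _ _ _ _ => by
    rw [sub_self, zero_mul]
    exact (SobolevBdd.const (d := d) (0 : F)).mono (by simp)⟩⟩

theorem UnifLip.const {a : Ω → F} {r : ℝ≥0} (h : ∀ ω ∈ G, ‖a ω‖ ≤ r) :
    UnifLip G fun ω (_ : Torus d → E) (_ : Torus d) => a ω :=
  UnifLip.of_bdd (r := r ^ 2) fun ω hω => (SobolevBdd.const (a ω)).mono (by
    gcongr
    exact h ω hω)

theorem UnifLip.neg {f : Ω → (Torus d → E) → (Torus d → F)} (hf : UnifLip G f) :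
    UnifLip G fun ω u => -f ω u := fun R => by
  obtain ⟨R', L, hL⟩ := hf R
  refine ⟨R', L, fun ω hω u hu => ⟨(hL ω hω u hu).1.neg, fun v δ hv huv => ?_⟩⟩
  rw [neg_sub_neg, ← neg_sub]
  exact ((hL ω hω u hu).2 v δ hv huv).neg

theorem UnifLip.conj {f : Ω → (Torus d → E) → (Torus d → ℂ)} (hf : UnifLip G f) :
    UnifLip G fun ω u x => conj (f ω u x) := fun R => by
  obtain ⟨R', L, hL⟩ := hf R
  refine ⟨R', L, fun ω hω u hu => ⟨(hL ω hω u hu).1.conj, fun v δ hv huv => ?_⟩⟩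
  have := ((hL ω hω u hu).2 v δ hv huv).conj
  simp only [Pi.sub_apply, map_sub] at this
  exact this

variable [CompleteSpace F]

theorem UnifLip.add (hd : d ≤ 3) {f g : Ω → (Torus d → E) → (Torus d → F)} (hf : UnifLip G f)
    (hg : UnifLip G g) : UnifLip G fun ω u => f ω u + g ω u := fun R => by
  obtain ⟨R₁, L₁, h₁⟩ := hf R
  obtain ⟨R₂, L₂, h₂⟩ := hg R
  refine ⟨2 * (R₁ + R₂), 2 * (L₁ + L₂), fun ω hω u hu =>
    ⟨(h₁ ω hω u hu).1.add hd (h₂ ω hω u hu).1, fun v δ hv huv => ?_⟩⟩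
  rw [add_sub_add_comm, mul_assoc, add_mul]
  exact ((h₁ ω hω u hu).2 v δ hv huv).add hd ((h₂ ω hω u hu).2 v δ hv huv)

theorem UnifLip.sum (hd : d ≤ 3) {ι : Type*} (s : Finset ι)
    {f : ι → Ω → (Torus d → E) → (Torus d → F)} (hf : ∀ i ∈ s, UnifLip G (f i)) :
    UnifLip G fun ω u => ∑ i ∈ s, f i ω u := by
  classical
  induction s using Finset.induction_on with
  | empty =>
    simp only [Finset.sum_empty]
    exact UnifLip.const (a := fun _ => 0) (r := 0) fun ω _ => by simp
  | insert i s hi ih =>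
    simp only [Finset.sum_insert hi]
    exact (hf i (Finset.mem_insert_self i s)).add hd
      (ih fun j hj => hf j (Finset.mem_insert_of_mem hj))

theorem UnifLip.sub (hd : d ≤ 3) {f g : Ω → (Torus d → E) → (Torus d → F)} (hf : UnifLip G f)
    (hg : UnifLip G g) : UnifLip G fun ω u => f ω u - g ω u := by
  simpa only [sub_eq_add_neg] using hf.add hd hg.neg

theorem UnifLip.smul (hd : d ≤ 3) {f : Ω → (Torus d → E) → (Torus d → ℂ)}
    {g : Ω → (Torus d → E) → (Torus d → F)} (hf : UnifLip G f) (hg : UnifLip G g) :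
    UnifLip G fun ω u x => f ω u x • g ω u x := fun R => by
  obtain ⟨R₁, L₁, h₁⟩ := hf R
  obtain ⟨R₂, L₂, h₂⟩ := hg R
  refine ⟨algConst d * (R₁ * R₂), 2 * (algConst d * (R₁ * L₂) + algConst d * (L₁ * R₂)),
    fun ω hω u hu => ⟨(h₁ ω hω u hu).1.smul hd (h₂ ω hω u hu).1, fun v δ hv huv => ?_⟩⟩
  -- The discrete product rule: each summand contains one difference and one factor bounded on the
  -- ball.
  have e : ((fun x => f ω u x • g ω u x) - fun x => f ω v x • g ω v x)
      = (fun x => f ω u x • (g ω u - g ω v) x) + fun x => (f ω u - f ω v) x • g ω v x := by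
    funext x
    simp only [Pi.sub_apply, Pi.add_apply, smul_sub, sub_smul]
    abel
  rw [e]
  refine (((h₁ ω hω u hu).1.smul hd ((h₂ ω hω u hu).2 v δ hv huv)).add hd
    (((h₁ ω hω u hu).2 v δ hv huv).smul hd (h₂ ω hω v hv).1)).mono (le_of_eq ?_)
  ring

theorem UnifLip.mul (hd : d ≤ 3) {f g : Ω → (Torus d → E) → (Torus d → ℂ)}
    (hf : UnifLip G f) (hg : UnifLip G g) : UnifLip G fun ω u x => f ω u x * g ω u x :=
  hf.smul hd hg

theorem UnifLip.pow (hd : d ≤ 3) {f : Ω → (Torus d → E) → (Torus d → ℂ)} (hf : UnifLip G f)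
    (k : ℕ) : UnifLip G fun ω u x => f ω u x ^ k := by
  induction k with
  | zero =>
    simp only [pow_zero]
    exact UnifLip.const (a := fun _ => 1) (r := 1) fun ω _ => by simp
  | succ k ih =>
    simp only [pow_succ]
    exact ih.mul hd hf

theorem UnifLip.const_smul (hd : d ≤ 3) (a : ℂ) {f : Ω → (Torus d → E) → (Torus d → F)}
    (hf : UnifLip G f) : UnifLip G fun ω u => a • f ω u :=
  (UnifLip.const (a := fun _ => a) (r := ‖a‖₊) fun _ _ => le_rfl).smul hd hf

theorem UnifLip.clm (hd : d ≤ 3) (A : F →L[ℂ] H) {f : Ω → (Torus d → E) → (Torus d → F)}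
    (hf : UnifLip G f) : UnifLip G fun ω u x => A (f ω u x) := fun R => by
  obtain ⟨R', L, hL⟩ := hf R
  refine ⟨‖A‖₊ ^ 2 * R', ‖A‖₊ ^ 2 * L, fun ω hω u hu =>
    ⟨(hL ω hω u hu).1.clm hd A, fun v δ hv huv => ?_⟩⟩
  have := ((hL ω hω u hu).2 v δ hv huv).clm hd A
  simp only [Pi.sub_apply, map_sub, ← mul_assoc] at this
  exact this

theorem UnifLip.fourierMul (hd : d ≤ 3) {m : Mode d → ℂ} {B : ℝ} (hm : ∀ n, ‖m n‖ ≤ B)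
    {f : Ω → (Torus d → E) → (Torus d → F)} (hf : UnifLip G f) :
    UnifLip G fun ω u => fourierMul m (f ω u) := fun R => by
  obtain ⟨R', L, hL⟩ := hf R
  have hm' : ∀ n, ‖m n‖ ≤ B.toNNReal := fun n => (hm n).trans (Real.le_coe_toNNReal B)
  refine ⟨B.toNNReal ^ 2 * R', B.toNNReal ^ 2 * L, fun ω hω u hu =>
    ⟨(hL ω hω u hu).1.fourierMul hd hm', fun v δ hv huv => ?_⟩⟩
  rw [← fourierMul_sub hd hm' (hL ω hω u hu).1 (hL ω hω v hv).1, mul_assoc]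
  exact ((hL ω hω u hu).2 v δ hv huv).fourierMul hd hm'

theorem UnifLip.schrodingerGroup (hd : d ≤ 3) (t : ℝ) {f : Ω → (Torus d → E) → (Torus d → F)}
    (hf : UnifLip G f) : UnifLip G fun ω u => schrodingerGroup t (f ω u) := by
  refine hf.fourierMul hd (B := 1) fun n => ?_
  rw [Complex.norm_exp]
  simp

/-! ### Stability of locally Lipschitz schemes -/

/-- The exceptional event of a composition lies in the union of those of its factors, so the
tolerance is halved at each induction step. -/
theorem exists_unifLip_iter {Ω : Type*} [MeasurableSpace Ω] {P : Measure Ω}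
    {S : RandomScheme Ω d E} {t₀ t : ℝ≥0}
    (hS : ∀ ℓ, ∀ η : ℝ≥0∞, η ≠ 0 → ∃ G, P Gᶜ ≤ η ∧ UnifLip G (S t₀ t ℓ)) (n : ℕ) :
    ∀ η : ℝ≥0∞, η ≠ 0 → ∃ G, P Gᶜ ≤ η ∧ UnifLip G fun ω v => S.iter t₀ t ω v n := by
  induction n with
  | zero => exact fun η _ => ⟨univ, by simp, UnifLip.id⟩
  | succ n ih =>
    intro η hη
    have hη2 : η / 2 ≠ 0 := by simpa using hη
    obtain ⟨G₁, h₁, hG₁⟩ := ih (η / 2) hη2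
    obtain ⟨G₂, h₂, hG₂⟩ := hS n (η / 2) hη2
    refine ⟨G₁ ∩ G₂, ?_, (hG₂.mono inter_subset_right).comp (hG₁.mono inter_subset_left)⟩
    rw [compl_inter]
    calc P (G₁ᶜ ∪ G₂ᶜ) ≤ P G₁ᶜ + P G₂ᶜ := measure_union_le _ _
      _ ≤ η / 2 + η / 2 := add_le_add h₁ h₂
      _ = η := ENNReal.add_halves η

/-- A random scheme each step of which is, up to small probability, uniformly locally Lipschitz is
stochastically stable. -/
theorem isStochasticallyStable_of_unifLip [CompleteSpace E] {Ω : Type*} [MeasurableSpace Ω] {P : Measure Ω}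
    (hd : d ≤ 3) (hE : HasFourierInversion d E) {S : RandomScheme Ω d E}
    (hS : ∀ t₀ t : ℝ≥0, 0 < t → ∀ ℓ, ∀ η : ℝ≥0∞, η ≠ 0 →
      ∃ G, P Gᶜ ≤ η ∧ UnifLip G (S t₀ t ℓ)) :
    IsStochasticallyStable 2 P S := by
  intro t₀ T _
  -- Any positive threshold would do, since the argument treats each step size separately.
  refine ⟨1, one_pos, fun ε hε t ht _ R => ?_⟩
  set l := comap (fun v : (Torus d → E) × (Torus d → E) => sobolevNorm 2 (v.1 - v.2)) (𝓝 0)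
    ⊓ 𝓟 (sobolevBall d E 2 R ×ˢ sobolevBall d E 2 R)
  have key : ∀ n : ℕ, Tendsto (fun v : (Torus d → E) × (Torus d → E) =>
      P {ω | (ε : ℝ≥0∞) ≤ sobolevNorm 2 (S.iter t₀ t ω v.1 n - S.iter t₀ t ω v.2 n)}) l (𝓝 0) := by
    intro n
    rw [ENNReal.tendsto_nhds_zero]
    intro η hη
    obtain ⟨G, hG, hLip⟩ := exists_unifLip_iter (hS t₀ t ht) n η hη.ne'
    -- `SobolevBdd` measures squared norms, and `2` is the constant in the comparison of weights;
    -- the same factor reappears in `2 * ρ ^ 2`.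
    obtain ⟨R', L, hL⟩ := hLip (2 * R ^ 2)
    set ρ : ℝ≥0 := ε / (2 * L + 2) with hρ
    have hρ0 : 0 < ρ := by positivity
    have hsmall : L * (2 * ρ ^ 2) < ε ^ 2 := by
      have : ε = (2 * L + 2) * ρ := by rw [hρ]; field_simp
      have h2 : ε ^ 2 = L * (2 * ρ ^ 2) + ((4 * L ^ 2 + 6 * L) * ρ ^ 2 + 4 * ρ ^ 2) := by
        rw [this]; ring
      rw [h2]
      have : 0 < 4 * ρ ^ 2 := by positivity
      exact lt_add_of_pos_right _ (by positivity)
    have hclose : ∀ᶠ v in l, sobolevNorm 2 (v.1 - v.2) < ρ :=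
      (tendsto_comap.mono_left inf_le_left).eventually_lt_const (by exact_mod_cast hρ0)
    have hball : ∀ᶠ v in l, v ∈ sobolevBall d E 2 R ×ˢ sobolevBall d E 2 R :=
      mem_inf_of_right (mem_principal_self _)
    filter_upwards [hclose, hball] with v hv hvR
    -- For such close initial values no `ω ∈ G` can produce a distance of at least `ε`, so the event
    -- lies in the complement of `G`.
    refine le_trans (measure_mono ?_) hG
    intro ω hω hωG
    obtain ⟨⟨hm₁, hb₁⟩, hm₂, hb₂⟩ := hvR
    have h1 := SobolevBdd.of_sobolevNorm hE hd hm₁ hb₁.le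
    have h2 := SobolevBdd.of_sobolevNorm hE hd hm₂ hb₂.le
    have h3 := SobolevBdd.of_sobolevNorm hE hd (hm₁.sub hm₂) hv.le
    have h4 := ((hL ω hωG _ h1).2 _ _ h2 h3).sobolevNorm_sq_le hd
    have h5 : (ε : ℝ≥0∞) ^ 2 ≤ (L * (2 * ρ ^ 2) : ℝ≥0) := (pow_le_pow_left' hω 2).trans h4
    exact absurd hsmall (not_lt.2 (by exact_mod_cast h5))
  -- Only indices `n ≤ T / t` occur in the supremum, so it is dominated by a finite sum of null
  -- functions.
  obtain ⟨N, hN⟩ := exists_nat_ge (T / t)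
  have hsum := tendsto_finsetSum (Finset.range (N + 1)) fun n _ => key n
  rw [Finset.sum_const_zero] at hsum
  refine tendsto_of_tendsto_of_tendsto_of_le_of_le tendsto_const_nhds hsum
    (fun _ => zero_le) fun v => iSup₂_le fun n hn => ?_
  refine Finset.single_le_sum (f := fun n => P {ω | (ε : ℝ≥0∞) ≤
    sobolevNorm 2 (S.iter t₀ t ω v.1 n - S.iter t₀ t ω v.2 n)}) (fun _ _ => zero_le) ?_
  have h1 : (n : ℝ≥0) ≤ T / t := by
    rw [le_div_iff₀ ht]
    exact (le_add_of_nonneg_left (zero_le)).trans hn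
  have h2 : (n : ℝ≥0) ≤ N := h1.trans hN
  exact Finset.mem_range.2 (Nat.lt_succ_of_le (by exact_mod_cast h2))

end

end LowRegScheme

namespace LowRegScheme

noncomputable section

variable {d : ℕ} {Ω : Type*} [MeasurableSpace Ω] {P : Measure Ω}

/-! ### Random variables of finite mean -/

/-- The nonnegative random variable `f` has finite mean. -/
def FiniteMean (f : Ω → ℝ≥0∞) (P : Measure Ω) : Prop := AEMeasurable f P ∧ ∫⁻ ω, f ω ∂P ≠ ⊤

theorem FiniteMean.add {f g : Ω → ℝ≥0∞} (hf : FiniteMean f P) (hg : FiniteMean g P) :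
    FiniteMean (fun ω => f ω + g ω) P :=
  ⟨hf.1.add hg.1, by
    rw [lintegral_add_left' hf.1]
    exact ENNReal.add_ne_top.2 ⟨hf.2, hg.2⟩⟩

theorem FiniteMean.sum {ι : Type*} (s : Finset ι) {f : ι → Ω → ℝ≥0∞}
    (hf : ∀ i, FiniteMean (f i) P) : FiniteMean (fun ω => ∑ i ∈ s, f i ω) P :=
  ⟨s.aemeasurable_fun_sum fun i _ => (hf i).1, by
    rw [lintegral_finsetSum' s fun i _ => (hf i).1]
    exact ENNReal.sum_ne_top.2 fun i _ => (hf i).2⟩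

/-- A random variable of finite mean is bounded up to small probability. -/
theorem FiniteMean.exists_bound {f : Ω → ℝ≥0∞} (hf : FiniteMean f P) {η : ℝ≥0∞} (hη : η ≠ 0) :
    ∃ r : ℝ≥0, P {ω | f ω ≤ r}ᶜ ≤ η := by
  by_cases hη' : η = ⊤
  · exact ⟨0, hη' ▸ le_top⟩
  set I := ∫⁻ ω, f ω ∂P
  have hI : I / η ≠ ⊤ := ENNReal.div_ne_top hf.2 hη
  -- Markov's inequality with a level at least `I / η`; the added `1` makes the level nonzero, so
  -- that it can be cancelled.
  refine ⟨(I / η).toNNReal + 1, ?_⟩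
  set r : ℝ≥0 := (I / η).toNNReal + 1
  have hr0 : (r : ℝ≥0∞) ≠ 0 := by
    have : 0 < r := add_pos_of_nonneg_of_pos zero_le one_pos
    exact_mod_cast this.ne'
  have hIr : I ≤ r * η := by
    have : I / η ≤ r := by
      rw [← ENNReal.coe_toNNReal hI]
      exact_mod_cast le_add_of_nonneg_right zero_le
    exact (ENNReal.div_le_iff hη hη').1 this
  have h1 := mul_meas_ge_le_lintegral₀ hf.1 (r : ℝ≥0∞)
  have h2 : (r : ℝ≥0∞) * P {ω | f ω ≤ r}ᶜ ≤ r * η := by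
    refine le_trans ?_ (h1.trans hIr)
    gcongr
    intro ω hω
    exact (not_le.1 (show ¬f ω ≤ r from hω)).le
  exact (ENNReal.mul_le_mul_iff_right hr0 ENNReal.coe_ne_top).1 h2

/-! ### Random coefficients with bounded second moments -/

/-- The random coefficients `X` have uniformly bounded second moments. -/
def BddSecondMoment (X : Mode d → Ω → ℂ) (P : Measure Ω) : Prop :=
  (∀ n, AEMeasurable (X n) P) ∧ ∃ C : ℝ≥0∞, C ≠ ⊤ ∧ ∀ n, ∫⁻ ω, ‖X n ω‖ₑ ^ 2 ∂P ≤ C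

theorem BddSecondMoment.const_mul {X : Mode d → Ω → ℂ} (hX : BddSecondMoment X P) (a : ℂ) :
    BddSecondMoment (fun n ω => a * X n ω) P := by
  obtain ⟨hm, C, hC, hXC⟩ := hX
  refine ⟨fun n => (hm n).const_mul a, ‖a‖ₑ ^ 2 * C, ENNReal.mul_ne_top (by simp) hC, fun n => ?_⟩
  simp only [enorm_mul, mul_pow]
  rw [lintegral_const_mul'' _ ((hm n).enorm.pow_const 2)]
  gcongr
  exact hXC n

theorem enorm_sub_sq_le {V : Type*} [SeminormedAddCommGroup V] (x y : V) :
    ‖x - y‖ₑ ^ 2 ≤ 2 * ‖x‖ₑ ^ 2 + 2 * ‖y‖ₑ ^ 2 := by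
  have h1 : ‖x - y‖ ^ 2 ≤ 2 * ‖x‖ ^ 2 + 2 * ‖y‖ ^ 2 := by
    have := norm_sub_le x y
    nlinarith [sq_nonneg (‖x‖ - ‖y‖), norm_nonneg (x - y)]
  simp only [← ofReal_norm, ← ENNReal.ofReal_pow (norm_nonneg _)]
  rw [← ENNReal.ofReal_ofNat, ← ENNReal.ofReal_mul (by norm_num),
    ← ENNReal.ofReal_mul (by norm_num), ← ENNReal.ofReal_add (by positivity) (by positivity)]
  exact ENNReal.ofReal_le_ofReal h1

theorem BddSecondMoment.sub {X Y : Mode d → Ω → ℂ} (hX : BddSecondMoment X P)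
    (hY : BddSecondMoment Y P) : BddSecondMoment (fun n ω => X n ω - Y n ω) P := by
  obtain ⟨hmX, C, hC, hXC⟩ := hX
  obtain ⟨hmY, D, hD, hYD⟩ := hY
  refine ⟨fun n => (hmX n).sub (hmY n), 2 * C + 2 * D,
    ENNReal.add_ne_top.2 ⟨ENNReal.mul_ne_top (by simp) hC, ENNReal.mul_ne_top (by simp) hD⟩,
    fun n => ?_⟩
  calc ∫⁻ ω, ‖X n ω - Y n ω‖ₑ ^ 2 ∂P ≤ ∫⁻ ω, 2 * ‖X n ω‖ₑ ^ 2 + 2 * ‖Y n ω‖ₑ ^ 2 ∂P :=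
        lintegral_mono fun ω => enorm_sub_sq_le _ _
    _ = 2 * ∫⁻ ω, ‖X n ω‖ₑ ^ 2 ∂P + 2 * ∫⁻ ω, ‖Y n ω‖ₑ ^ 2 ∂P := by
        rw [lintegral_add_left' (((hmX n).enorm.pow_const 2).const_mul _),
          lintegral_const_mul'' _ ((hmX n).enorm.pow_const 2),
          lintegral_const_mul'' _ ((hmY n).enorm.pow_const 2)]
    _ ≤ _ := by
        gcongr
        · exact hXC n
        · exact hYD n

theorem BddSecondMoment.conj_comp_neg {X : Mode d → Ω → ℂ} (hX : BddSecondMoment X P) :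
    BddSecondMoment (fun n ω => conj (X (-n) ω)) P := by
  obtain ⟨hm, C, hC, hXC⟩ := hX
  refine ⟨fun n => Complex.continuous_conj.measurable.comp_aemeasurable (hm (-n)), C, hC,
    fun n => ?_⟩
  simpa only [RCLike.enorm_conj] using hXC (-n)

/-- By Tonelli the mean is a weighted sum of the second moments of the individual modes. -/
theorem BddSecondMoment.finiteMean_sqWeightNorm {X : Mode d → Ω → ℂ} (hX : BddSecondMoment X P)
    {c : Mode d → ℂ} (hc : sqWeightNorm c ≠ ⊤) :
    FiniteMean (fun ω => sqWeightNorm fun n => c n * X n ω) P := by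
  obtain ⟨hm, C, hC, hXC⟩ := hX
  have hterm : ∀ n, AEMeasurable (fun ω => weight n * ‖c n * X n ω‖ₑ ^ 2) P := fun n =>
    (((hm n).const_mul (c n)).enorm.pow_const 2).const_mul _
  refine ⟨AEMeasurable.tsum hterm, ne_top_of_le_ne_top (ENNReal.mul_ne_top hc hC) ?_⟩
  simp only [sqWeightNorm]
  rw [lintegral_tsum hterm, ← ENNReal.tsum_mul_right]
  refine ENNReal.tsum_le_tsum fun n => ?_
  simp only [enorm_mul, mul_pow, ← mul_assoc]
  rw [lintegral_const_mul'' _ ((hm n).enorm.pow_const 2)]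
  gcongr
  exact hXC n

theorem one_le_freqSq {n : Mode d} (hn : n ≠ 0) : 1 ≤ freqSq n := by
  obtain ⟨j, hj⟩ := Function.ne_iff.1 hn
  refine le_trans ?_ (sq_le_freqSq n j)
  have hj' : n j ≠ 0 := hj
  have h0 : 0 < (n j) ^ 2 := by positivity
  have h1 : 1 ≤ (n j) ^ 2 := h0
  exact_mod_cast h1

/-- The trace conditions give the zero mode no weight. It adds only one finite term, while `(1 +
|n|²)² ≤ 4|n|⁴` for every other mode. -/
theorem sqWeightNorm_ne_top_of_summable {c : Mode d → ℂ} {g : Mode d → ℝ} (hg : Summable g)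
    (h : ∀ n, n ≠ 0 → ‖c n‖ ^ 2 * freqSq n ^ 2 ≤ g n) : sqWeightNorm c ≠ ⊤ := by
  have hs : Summable fun n : Mode d => 4 * |g n| + if n = 0 then ‖c 0‖ ^ 2 else 0 :=
    (hg.abs.mul_left 4).add
      (summable_of_ne_finset_zero (s := {0}) fun n hn => by simp at hn; simp [hn])
  refine ne_top_of_le_ne_top hs.tsum_ofReal_ne_top (ENNReal.tsum_le_tsum fun n => ?_)
  rw [weight, ← ofReal_norm, ← ENNReal.ofReal_pow (norm_nonneg _),
    ← ENNReal.ofReal_mul (sq_nonneg _)]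
  refine ENNReal.ofReal_le_ofReal ?_
  by_cases hn : n = 0
  · subst hn
    simp only [freqSq, Pi.zero_apply, Int.cast_zero, ne_eq, OfNat.ofNat_ne_zero,
      not_false_eq_true, zero_pow, Finset.sum_const_zero, add_zero, one_pow, one_mul, if_true]
    linarith [abs_nonneg (g 0)]
  · have h1 := one_le_freqSq hn
    have h2 : (1 + freqSq n) ^ 2 ≤ 4 * freqSq n ^ 2 := by nlinarith
    have h3 := (h n hn).trans (le_abs_self _)
    have h4 := mul_le_mul_of_nonneg_right h2 (sq_nonneg ‖c n‖)
    simp only [hn, if_false, add_zero]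
    linarith

/-! ### Second moments of the Brownian noise -/

theorem lintegral_enorm_sq_gaussianReal (v : ℝ≥0) : ∫⁻ x, ‖x‖ₑ ^ 2 ∂(gaussianReal 0 v) = v := by
  have h1 := (memLp_id_gaussianReal (μ := 0) (v := v) 2).ofReal_variance_eq
  rw [variance_id_gaussianReal, evariance] at h1
  simp only [id_eq, integral_id_gaussianReal, sub_zero] at h1
  rw [← h1]
  simp

theorem lintegral_brownian_incr_sq {B : ℝ≥0 → Ω → ℝ} (hB : IsBrownianReal B P) (a s : ℝ≥0) :
    ∫⁻ ω, ‖B (a + s) ω - B a ω‖ₑ ^ 2 ∂P = s := by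
  have h := hB.hasLaw_sub (a + s) a
  have hs : nndist (a + s).1 a.1 = s := by
    ext
    simp
  rw [hs] at h
  rw [← lintegral_enorm_sq_gaussianReal, ← h.map_eq, lintegral_map' (by fun_prop) h.aemeasurable]
  rfl

theorem finiteMean_brownian_normIncr {B : ℝ≥0 → Ω → ℝ} (hB : IsBrownianReal B P) (a t : ℝ≥0) :
    FiniteMean (fun ω => ‖normIncr (fun s => B s ω) a t‖ₑ ^ 2) P := by
  have hm : AEMeasurable (fun ω => B (a + t) ω - B a ω) P :=
    (hB.aemeasurable (a + t)).sub (hB.aemeasurable a)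
  simp only [FiniteMean, normIncr, enorm_smul, mul_pow]
  refine ⟨(hm.enorm.pow_const 2).const_mul _, ?_⟩
  rw [lintegral_const_mul'' _ (hm.enorm.pow_const 2), lintegral_brownian_incr_sq hB]
  exact ENNReal.mul_ne_top (by simp) (by simp)

theorem enorm_sq_eq_re_im (z : ℂ) : ‖z‖ₑ ^ 2 = ‖z.re‖ₑ ^ 2 + ‖z.im‖ₑ ^ 2 := by
  simp only [← ofReal_norm, ← ENNReal.ofReal_pow (norm_nonneg _)]
  rw [← ENNReal.ofReal_add (by positivity) (by positivity), ← Complex.normSq_eq_norm_sq,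
    Complex.normSq_apply, Real.norm_eq_abs, Real.norm_eq_abs, sq_abs, sq_abs, sq, sq]

namespace IsCylindricalWiener

variable {W : Mode d → ℝ≥0 → Ω → ℂ}

theorem aemeasurable (hW : IsCylindricalWiener W P) (n : Mode d) (s : ℝ≥0) :
    AEMeasurable (W n s) P := by
  have h := (Complex.measurable_ofReal.comp_aemeasurable ((hW.re_brownian n).aemeasurable s)).add
    ((Complex.measurable_ofReal.comp_aemeasurable ((hW.im_brownian n).aemeasurable s)).mul_const
      Complex.I)
  exact h.congr (ae_of_all _ fun ω => Complex.re_add_im _)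

theorem ae_continuous (hW : IsCylindricalWiener W P) (n : Mode d) :
    ∀ᵐ ω ∂P, Continuous fun s => W n s ω := by
  filter_upwards [(hW.re_brownian n).cont, (hW.im_brownian n).cont] with ω h1 h2
  have : (fun s => W n s ω) = fun s => ((W n s ω).re : ℂ) + (W n s ω).im * Complex.I :=
    funext fun s => (Complex.re_add_im _).symm
  rw [this]
  exact (Complex.continuous_ofReal.comp h1).add
    ((Complex.continuous_ofReal.comp h2).mul continuous_const)

theorem lintegral_incr_sq (hW : IsCylindricalWiener W P) (n : Mode d) (a s : ℝ≥0) :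
    ∫⁻ ω, ‖W n (a + s) ω - W n a ω‖ₑ ^ 2 ∂P = 2 * s := by
  simp only [enorm_sq_eq_re_im, Complex.sub_re, Complex.sub_im]
  have hm : AEMeasurable (fun ω => ‖(W n (a + s) ω).re - (W n a ω).re‖ₑ ^ 2) P :=
    (((hW.re_brownian n).aemeasurable _).sub ((hW.re_brownian n).aemeasurable _)).enorm.pow_const 2
  rw [lintegral_add_left' hm, lintegral_brownian_incr_sq (hW.re_brownian n), lintegral_brownian_incr_sq (hW.im_brownian n),
    two_mul]

theorem bddSecondMoment_incr (hW : IsCylindricalWiener W P) (a t : ℝ≥0) :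
    BddSecondMoment (fun n ω => W n (a + t) ω - W n a ω) P :=
  ⟨fun n => (hW.aemeasurable n _).sub (hW.aemeasurable n _), 2 * t,
    ENNReal.mul_ne_top (by simp) (by simp), fun n => (hW.lintegral_incr_sq n a t).le⟩

theorem bddSecondMoment_normIncr (hW : IsCylindricalWiener W P) (a t : ℝ≥0) :
    BddSecondMoment (fun n ω => normIncr (fun s => W n s ω) a t) P := by
  have h := (hW.bddSecondMoment_incr a t).const_mul (((√(t : ℝ))⁻¹ : ℝ) : ℂ)
  simpa only [normIncr, Complex.real_smul] using h

/-- Almost surely the path is continuous and the integral is a limit of right Riemann sums. This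
gives measurability, and Fatou's lemma carries over the moment bound for the sums. -/
theorem bddSecondMoment_timeIntegral (hW : IsCylindricalWiener W P) (a t : ℝ≥0) :
    BddSecondMoment (fun n ω => timeIntegral (fun s => W n s ω) a t) P := by
  set X : Mode d → ℕ → Ω → ℂ := fun n N ω => ∑ i ∈ Finset.range N,
    (((t : ℝ) / N : ℝ) : ℂ) *
      (W n (a + (((i + 1 : ℕ) : ℝ) * ((t : ℝ) / N)).toNNReal) ω - W n a ω) with hX
  have hXm : ∀ n N, AEMeasurable (X n N) P := fun n N =>
    Finset.aemeasurable_fun_sum _ fun i _ =>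
      ((hW.aemeasurable n _).sub (hW.aemeasurable n _)).const_mul _
  have hlim : ∀ n, ∀ᵐ ω ∂P, Tendsto (fun N => X n N ω) atTop
      (𝓝 (timeIntegral (fun s => W n s ω) a t)) := fun n => by
    filter_upwards [hW.ae_continuous n] with ω hω
    exact tendsto_rightSum (g := fun s => W n (a + s.toNNReal) ω - W n a ω)
      (by fun_prop) t t.2
  -- Cauchy-Schwarz over the `N` terms, each increment having second moment at most `2t`: the bound
  -- is `N · N · (t/N)² · 2t`. For `N = 0` the sum is empty.
  have hbd : ∀ n N, ∫⁻ ω, ‖X n N ω‖ₑ ^ 2 ∂P ≤ 2 * t ^ 3 := fun n N => by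
    rcases Nat.eq_zero_or_pos N with rfl | hN
    · simp [hX]
    have hN0 : (0 : ℝ) < N := by exact_mod_cast hN
    set τ : ℝ≥0 := t / N with hτ
    have hτ' : (t : ℝ) / N = τ := by rw [hτ]; push_cast; rfl
    have hpt : ∀ ω, ‖X n N ω‖ₑ ^ 2 ≤ N * ∑ i ∈ Finset.range N,
        (τ : ℝ≥0∞) ^ 2 * ‖W n (a + (i + 1 : ℕ) * τ) ω - W n a ω‖ₑ ^ 2 := fun ω => by
      have e : ∀ i : ℕ, (((i + 1 : ℕ) : ℝ) * ((t : ℝ) / N)).toNNReal = (i + 1 : ℕ) * τ :=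
        fun i => by
          rw [hτ', ← NNReal.coe_natCast, ← NNReal.coe_mul, Real.toNNReal_coe]
      have h1 : ‖X n N ω‖₊ ≤ ∑ i ∈ Finset.range N,
          τ * ‖W n (a + (i + 1 : ℕ) * τ) ω - W n a ω‖₊ := by
        refine (nnnorm_sum_le _ _).trans (le_of_eq (Finset.sum_congr rfl fun i _ => ?_))
        rw [e, hτ', nnnorm_mul]
        congr 1
        ext
        simp
      have h2 : ‖X n N ω‖₊ ^ 2 ≤ N * ∑ i ∈ Finset.range N,
          τ ^ 2 * ‖W n (a + (i + 1 : ℕ) * τ) ω - W n a ω‖₊ ^ 2 := by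
        refine (pow_le_pow_left' h1 2).trans ?_
        have := sq_sum_le_card_mul_sum_sq (s := Finset.range N)
          (f := fun i => τ * ‖W n (a + (i + 1 : ℕ) * τ) ω - W n a ω‖₊)
        simpa only [Finset.card_range, mul_pow] using this
      simp only [enorm_eq_nnnorm]
      exact_mod_cast h2
    have hm : ∀ i : ℕ, AEMeasurable (fun ω => ‖W n (a + (i + 1 : ℕ) * τ) ω - W n a ω‖ₑ ^ 2) P :=
      fun i => ((hW.aemeasurable n _).sub (hW.aemeasurable n _)).enorm.pow_const 2
    calc ∫⁻ ω, ‖X n N ω‖ₑ ^ 2 ∂P ≤ ∫⁻ ω, N * ∑ i ∈ Finset.range N,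
          (τ : ℝ≥0∞) ^ 2 * ‖W n (a + (i + 1 : ℕ) * τ) ω - W n a ω‖ₑ ^ 2 ∂P := lintegral_mono hpt
      _ = N * ∑ i ∈ Finset.range N, (τ : ℝ≥0∞) ^ 2 * (2 * ((i + 1 : ℕ) * τ : ℝ≥0)) := by
          rw [lintegral_const_mul'' _
            (Finset.aemeasurable_fun_sum _ fun i _ => (hm i).const_mul _),
            lintegral_finsetSum' _ fun i _ => (hm i).const_mul _]
          congr 1
          refine Finset.sum_congr rfl fun i _ => ?_
          rw [lintegral_const_mul'' _ (hm i), hW.lintegral_incr_sq]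
      _ ≤ N * ∑ i ∈ Finset.range N, (τ : ℝ≥0∞) ^ 2 * (2 * t) := by
          gcongr with i hi
          have h1 : ((i + 1 : ℕ) : ℝ≥0) ≤ N := by exact_mod_cast Finset.mem_range.1 hi
          have hNt : (N : ℝ≥0) * τ = t := by
            have : (N : ℝ≥0) ≠ 0 := by exact_mod_cast hN.ne'
            rw [hτ]; field_simp
          rw [← hNt]
          gcongr
      _ = 2 * t ^ 3 := by
          have hNt : (N : ℝ≥0∞) * τ = t := by
            have : (N : ℝ≥0) * τ = t := by
              have : (N : ℝ≥0) ≠ 0 := by exact_mod_cast hN.ne'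
              rw [hτ]; field_simp
            exact_mod_cast this
          rw [Finset.sum_const, Finset.card_range, nsmul_eq_mul]
          calc (N : ℝ≥0∞) * (N * ((τ : ℝ≥0∞) ^ 2 * (2 * t))) = 2 * (N * τ) ^ 2 * t := by ring
            _ = _ := by rw [hNt]; ring
  refine ⟨fun n => aemeasurable_of_tendsto_metrizable_ae atTop (hXm n) (hlim n), 2 * t ^ 3,
    ENNReal.mul_ne_top (by simp) (by simp), fun n => ?_⟩
  calc ∫⁻ ω, ‖timeIntegral (fun s => W n s ω) a t‖ₑ ^ 2 ∂P
      = ∫⁻ ω, liminf (fun N => ‖X n N ω‖ₑ ^ 2) atTop ∂P := by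
        refine lintegral_congr_ae ?_
        filter_upwards [hlim n] with ω hω
        exact ((ENNReal.continuous_pow 2).continuousAt.tendsto.comp hω.enorm).liminf_eq.symm
    _ ≤ liminf (fun N => ∫⁻ ω, ‖X n N ω‖ₑ ^ 2 ∂P) atTop :=
        lintegral_liminf_le' fun N => (hXm n N).enorm.pow_const 2
    _ ≤ 2 * t ^ 3 := by
        refine liminf_le_of_le (by isBoundedDefault) fun b hb => ?_
        obtain ⟨N, hN⟩ := hb.exists
        exact hN.trans (hbd n N)

theorem bddSecondMoment_wienerIntegral (hW : IsCylindricalWiener W P) (a t : ℝ≥0) :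
    BddSecondMoment (fun n ω => wienerIntegral (fun s => W n s ω) a t) P :=
  ((hW.bddSecondMoment_incr a t).const_mul (t : ℂ)).sub (hW.bddSecondMoment_timeIntegral a t)

end IsCylindricalWiener

end

end LowRegScheme

namespace LowRegScheme

noncomputable section

variable {d : ℕ} {E : Type*} [NormedAddCommGroup E] [NormedSpace ℂ E] {Ω : Type*} {G : Set Ω}

/-! ### Each scheme is locally Lipschitz -/

theorem UnifLip.field {c : Ω → Mode d → ℂ} {r : ℝ≥0} (h : ∀ ω ∈ G, sqWeightNorm (c ω) ≤ r) :
    UnifLip G fun ω (_ : Torus d → E) => field (c ω) :=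
  UnifLip.of_bdd fun ω hω => SobolevBdd.field (h ω hω)

/-- The step is assembled from the closure rules; only the noise field is random, and the trace is a
constant. -/
theorem unifLip_nlsStepHalf (hd : d ≤ 3) (Φ : Mode d → ℂ) (θ : ℝ) (t : ℝ≥0)
    {χ : Ω → Mode d → ℂ} {r : ℝ≥0} (hχ : ∀ ω ∈ G, sqWeightNorm (fun n => Φ n * χ ω n) ≤ r) :
    UnifLip G fun ω => nlsStepHalf Φ θ t (χ ω) := by
  have hf : UnifLip G fun ω (_ : Torus d → ℂ) => LowRegScheme.field fun n => Φ n * χ ω n :=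
    UnifLip.field hχ
  have hid : UnifLip G fun _ (u : Torus d → ℂ) => u := UnifLip.id
  have htr : UnifLip G fun _ (_ : Torus d → ℂ) (_ : Torus d) => ∑' n, Φ n ^ 2 :=
    UnifLip.const (r := ‖∑' n, Φ n ^ 2‖₊) fun _ _ => le_rfl
  have hmul := UnifLip.fourierMul hd (B := 1)
    (m := fun n : Mode d => f₁ (Complex.I * θ * (-freqSq n : ℝ))) (fun n => by
      rw [mul_assoc, ← Complex.ofReal_mul]
      exact norm_f₁_le_one _) hid.conj
  exact (((hid.schrodingerGroup hd t).sub hd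
    ((((hid.pow hd 2).mul hd hmul).schrodingerGroup hd t).const_smul hd _)).sub hd
    (((hid.mul hd hf).schrodingerGroup hd t).const_smul hd _)).sub hd
    (((hid.mul hd ((hf.pow hd 2).sub hd htr)).schrodingerGroup hd t).const_smul hd _)

/-- Termwise `xy ≤ x² + y²` with `x = |Φ_n χ_n|` and `y = |Φ_n|`, the weights being at least `1`. -/
theorem norm_tsum_trace_le {Φ χ : Mode d → ℂ} {r s : ℝ≥0}
    (h : sqWeightNorm (fun n => Φ n * χ n) ≤ r) (hΦ : sqWeightNorm Φ ≤ s) :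
    ‖∑' n, Φ n * χ n * conj (Φ n)‖ ≤ (r + s : ℝ≥0) := by
  have h1 : ‖∑' n, Φ n * χ n * conj (Φ n)‖ₑ ≤ (r + s : ℝ≥0) := by
    push_cast
    refine enorm_tsum_le_tsum_enorm.trans (le_trans ?_ (add_le_add h hΦ))
    rw [sqWeightNorm, sqWeightNorm, ← ENNReal.tsum_add]
    refine ENNReal.tsum_le_tsum fun n => ?_
    rw [enorm_mul, RCLike.enorm_conj]
    set x := ‖Φ n * χ n‖ₑ
    set y := ‖Φ n‖ₑ
    have hx : x ^ 2 ≤ weight n * x ^ 2 := le_mul_of_one_le_left zero_le (one_le_weight n)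
    have hy : y ^ 2 ≤ weight n * y ^ 2 := le_mul_of_one_le_left zero_le (one_le_weight n)
    rcases le_total x y with hxy | hxy
    · refine (mul_le_mul_left hxy y).trans ?_
      rw [← sq]
      exact hy.trans le_add_self
    · refine (mul_le_mul_right hxy x).trans ?_
      rw [← sq]
      exact hx.trans le_self_add
  rw [enorm_eq_nnnorm] at h1
  exact_mod_cast h1

theorem unifLip_nlsStepOne (hd : d ≤ 3) (Φ : Mode d → ℂ) {ψ : Fin d → Mode d → ℂ}
    (hψ : ∀ j, ∃ B : ℝ, ∀ n, ‖ψ j n‖ ≤ B) (t : ℝ≥0) {χ J K : Ω → Mode d → ℂ} {r s : ℝ≥0}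
    (hΦ : sqWeightNorm Φ ≤ s)
    (hχ : ∀ ω ∈ G, sqWeightNorm (fun n => Φ n * χ ω n) ≤ r)
    (hJ : ∀ ω ∈ G, sqWeightNorm (fun n => (-freqSq n : ℝ) * Φ n * J ω n) ≤ r)
    (hJ' : ∀ ω ∈ G, ∀ j, sqWeightNorm (fun n => Complex.I * (n j : ℂ) * Φ n * J ω n) ≤ r)
    (hK : ∀ ω ∈ G, sqWeightNorm (fun n => Φ n * conj (K ω (-n))) ≤ r) :
    UnifLip G fun ω => nlsStepOne Φ ψ t (χ ω) (J ω) (K ω) := by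
  have hid : UnifLip G fun _ (u : Torus d → ℂ) => u := UnifLip.id
  have hf : UnifLip G fun ω (_ : Torus d → ℂ) => LowRegScheme.field fun n => Φ n * χ ω n :=
    UnifLip.field hχ
  have hfJ : UnifLip G fun ω (_ : Torus d → ℂ) =>
      LowRegScheme.field fun n => (-freqSq n : ℝ) * Φ n * J ω n := UnifLip.field hJ
  have hfK : UnifLip G fun ω (_ : Torus d → ℂ) =>
      LowRegScheme.field fun n => Φ n * conj (K ω (-n)) := UnifLip.field hK
  have hc : ∀ a : ℂ, UnifLip G fun _ (_ : Torus d → ℂ) (_ : Torus d) => a := fun a =>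
    UnifLip.const (r := ‖a‖₊) fun _ _ => le_rfl
  have htr : UnifLip G fun ω (_ : Torus d → ℂ) (_ : Torus d) =>
      ∑' n, Φ n * χ ω n * conj (Φ n) :=
    UnifLip.const (r := r + s) fun ω hω => norm_tsum_trace_le (hχ ω hω) hΦ
  have hgrad : UnifLip G fun ω (u : Torus d → ℂ) x => ∑ j, fourierMul (ψ j) u x *
      LowRegScheme.field (fun n => Complex.I * (n j : ℂ) * Φ n * J ω n) x := by
    have h := UnifLip.sum hd Finset.univ (f := fun j ω (u : Torus d → ℂ) x => fourierMul (ψ j) u x *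
      LowRegScheme.field (fun n => Complex.I * (n j : ℂ) * Φ n * J ω n) x) (G := G) fun j _ => by
        obtain ⟨B, hB⟩ := hψ j
        exact (hid.fourierMul hd hB).mul hd (UnifLip.field fun ω hω => hJ' ω hω j)
    -- The two sides differ only in whether the sum over `j` is taken pointwise or as a sum of
    -- functions.
    convert h using 4
    simp
  have hcub := (hid.pow hd 2).mul hd hid.conj
  exact ((((((((hid.schrodingerGroup hd t).sub hd
    ((hcub.schrodingerGroup hd t).const_smul hd _)).sub hd
    (((hid.mul hd hf).schrodingerGroup hd t).const_smul hd _)).add hd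
    (((hid.mul hd hfJ).add hd ((hc 2).mul hd hgrad)).schrodingerGroup hd t)).sub hd
    (((hid.mul hd ((hf.pow hd 2).sub hd (hc 1))).schrodingerGroup hd t).const_smul hd _)).sub hd
    (((hcub.mul hd hf).schrodingerGroup hd t).const_smul hd _)).add hd
    ((((hid.mul hd (hid.conj.pow hd 2)).mul hd hfK).schrodingerGroup hd t).const_smul hd _)).add hd
    (((hid.mul hd (((hc (1 / 6)).mul hd (hf.pow hd 3)).sub hd
      ((hc (1 / 2)).mul hd htr))).schrodingerGroup hd t).const_smul hd _))

theorem UnifLip.matAct (hd : d ≤ 3) (A : Matrix (Fin 2) (Fin 2) ℂ)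
    {f : Ω → (Torus d → E) → (Torus d → C2)} (hf : UnifLip G f) :
    UnifLip G fun ω u => matAct A (f ω u) :=
  hf.clm hd (LinearMap.toContinuousLinearMap (Matrix.toEuclideanLin A))

/-- The squared Euclidean norm is the sum of `conj u_i · u_i` over the two components, so the
nonlinearity is a polynomial in components and their conjugates. -/
theorem UnifLip.cubic (hd : d ≤ 3) :
    UnifLip G fun _ (u : Torus d → C2) x => ((‖u x‖ : ℂ) ^ 2) • u x := by
  have hid : UnifLip G fun _ (u : Torus d → C2) => u := UnifLip.id
  have hcoord : ∀ i : Fin 2, UnifLip G fun _ (u : Torus d → C2) x => u x i := fun i =>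
    hid.clm hd (EuclideanSpace.proj (𝕜 := ℂ) i)
  have h := ((((hcoord 0).conj.mul hd (hcoord 0)).add hd
    ((hcoord 1).conj.mul hd (hcoord 1))).smul hd hid)
  refine (congrArg (UnifLip G) ?_).mp h
  funext _ u x
  congr 1
  have h2 : (‖u x‖ : ℂ) ^ 2 = ((‖u x‖ ^ 2 : ℝ) : ℂ) := by push_cast; rfl
  rw [h2, EuclideanSpace.norm_sq_eq, Fin.sum_univ_two]
  simp only [Pi.add_apply, Complex.conj_mul']
  push_cast
  rfl

theorem unifLip_manakovStep (hd : d ≤ 3) (γ : ℝ) {ψ₁ ψ₂ : Mode d → ℂ}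
    (h₁ : ∃ B : ℝ, ∀ n, ‖ψ₁ n‖ ≤ B) (h₂ : ∃ B : ℝ, ∀ n, ‖ψ₂ n‖ ≤ B) (t : ℝ≥0)
    {χ : Ω → Fin 3 → ℝ} {r : ℝ≥0} (hχ : ∀ ω ∈ G, ∀ n, ‖χ ω n‖ ≤ r) :
    UnifLip G fun ω => manakovStep γ ψ₁ ψ₂ t (χ ω) := by
  obtain ⟨B₁, h₁⟩ := h₁
  obtain ⟨B₂, h₂⟩ := h₂
  have hid : UnifLip G fun _ (u : Torus d → C2) => u := UnifLip.id
  have hc₁ : ∀ n, UnifLip G fun ω (_ : Torus d → C2) (_ : Torus d) => (χ ω n : ℂ) := fun n =>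
    UnifLip.const (r := r) fun ω hω => by
      rw [Complex.norm_real]
      exact hχ ω hω n
  have hc : ∀ a : ℂ, UnifLip G fun _ (_ : Torus d → C2) (_ : Torus d) => a := fun a =>
    UnifLip.const (r := ‖a‖₊) fun _ _ => le_rfl
  have hc₂ : ∀ n m, UnifLip G fun ω (_ : Torus d → C2) (_ : Torus d) =>
      ((1 / 2 * (χ ω n ^ 2 - 1) + χ ω n * χ ω m : ℝ) : ℂ) := fun n m => by
    have h := ((hc (1 / 2)).mul hd (((hc₁ n).pow hd 2).sub hd (hc 1))).add hd
      ((hc₁ n).mul hd (hc₁ m))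
    refine (congrArg (UnifLip G) ?_).mp h
    funext ω _ x
    simp
  have hA : UnifLip G fun ω (u : Torus d → C2) => ∑ n : Fin 3,
      (χ ω n : ℂ) • matAct (pauli n) (schrodingerGroup t (fourierMul ψ₁ u)) :=
    UnifLip.sum hd _ fun n _ =>
      (hc₁ n).smul hd (((hid.fourierMul hd h₁).schrodingerGroup hd t).matAct hd (pauli n))
  have hB : UnifLip G fun ω (u : Torus d → C2) => ∑ n : Fin 3, ∑ m : Fin 3, if n < m then
        ((1 / 2 * (χ ω n ^ 2 - 1) + χ ω n * χ ω m : ℝ) : ℂ) •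
          matAct (pauli m * pauli n) (schrodingerGroup t (fourierMul ψ₂ u)) else 0 := by
    refine UnifLip.sum hd _ fun n _ => UnifLip.sum hd _ fun m _ => ?_
    by_cases hnm : n < m
    · simp only [hnm, if_true]
      exact (hc₂ n m).smul hd
        (((hid.fourierMul hd h₂).schrodingerGroup hd t).matAct hd (pauli m * pauli n))
    · simp only [hnm, if_false]
      exact UnifLip.const (a := fun _ => (0 : C2)) (r := 0) fun _ _ => by simp
  exact (((hid.schrodingerGroup hd t).sub hd
    (((UnifLip.cubic hd).schrodingerGroup hd t).const_smul hd _)).sub hd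
    (hA.const_smul hd _)).add hd (hB.const_smul hd _)

/-! ### Stability of the schemes -/

theorem isStochasticallyStable_nlsSchemeHalf {Ω : Type*} [MeasurableSpace Ω] {P : Measure Ω}
    {d : ℕ} (hd : d ≤ 3) {W : Mode d → ℝ≥0 → Ω → ℂ} {Φ : Mode d → ℂ} (θ : ℝ≥0 → ℝ)
    (hW : IsCylindricalWiener W P) (hΦ : Summable fun n => ‖Φ n‖ ^ 2 * freqSq n ^ 2) :
    IsStochasticallyStable 2 P (nlsSchemeHalf Φ θ W) := by
  refine isStochasticallyStable_of_unifLip hd hasFourierInversion_complex fun t₀ t _ ℓ η hη => ?_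
  have hΦ' : sqWeightNorm Φ ≠ ⊤ := sqWeightNorm_ne_top_of_summable hΦ fun n _ => le_rfl
  obtain ⟨r, hr⟩ := ((hW.bddSecondMoment_normIncr (t₀ + ℓ * t) t).finiteMean_sqWeightNorm
    hΦ').exists_bound hη
  exact ⟨_, hr, unifLip_nlsStepHalf hd Φ (θ t) t fun ω hω => hω⟩

/-- The field `∫ s ΔΦ dW` must lie in `H²`, which costs two further derivatives of `Φ` and accounts
for the weight `|n|⁸`; the other noise fields need less. -/
theorem isStochasticallyStable_nlsSchemeOne {Ω : Type*} [MeasurableSpace Ω] {P : Measure Ω}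
    {d : ℕ} (hd : d ≤ 3) {W : Mode d → ℝ≥0 → Ω → ℂ} {Φ : Mode d → ℂ}
    {ψ : Fin d → ℝ≥0 → Mode d → ℂ} (hW : IsCylindricalWiener W P)
    (hΦ : Summable fun n => ‖Φ n‖ ^ 2 * freqSq n ^ 4) (hψ : ∀ j, IsFilter (ψ j)) :
    IsStochasticallyStable 2 P (nlsSchemeOne Φ ψ W) := by
  refine isStochasticallyStable_of_unifLip hd hasFourierInversion_complex fun t₀ t ht ℓ η hη => ?_
  have h₀ : sqWeightNorm Φ ≠ ⊤ := sqWeightNorm_ne_top_of_summable hΦ fun n hn => by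
    gcongr
    · exact one_le_freqSq hn
    · norm_num
  have h₁ : sqWeightNorm (fun n => ((-freqSq n : ℝ) : ℂ) * Φ n) ≠ ⊤ :=
    sqWeightNorm_ne_top_of_summable hΦ fun n _ => by
      rw [norm_mul, Complex.norm_real, norm_neg, mul_pow, Real.norm_eq_abs, sq_abs]
      exact le_of_eq (by ring)
  have h₂ : ∀ j, sqWeightNorm (fun n : Mode d => Complex.I * (n j : ℂ) * Φ n) ≠ ⊤ := fun j =>
    sqWeightNorm_ne_top_of_summable hΦ fun n hn => by
      have e : ‖(n j : ℂ)‖ ^ 2 = (n j : ℝ) ^ 2 := by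
        rw [Complex.norm_intCast, sq_abs]
      rw [norm_mul, norm_mul, Complex.norm_I, one_mul, mul_pow, e]
      have h1 := one_le_freqSq hn
      calc (n j : ℝ) ^ 2 * ‖Φ n‖ ^ 2 * freqSq n ^ 2
          ≤ freqSq n ^ 2 * ‖Φ n‖ ^ 2 * freqSq n ^ 2 :=
            mul_le_mul_of_nonneg_right (mul_le_mul_of_nonneg_right
              ((sq_le_freqSq n j).trans (le_self_pow₀ h1 two_ne_zero)) (sq_nonneg _)) (sq_nonneg _)
        _ = _ := by ring
  set a := t₀ + ℓ * t
  have hJ := hW.bddSecondMoment_wienerIntegral a t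
  have n₁ := (hW.bddSecondMoment_normIncr a t).finiteMean_sqWeightNorm h₀
  have n₂ := hJ.finiteMean_sqWeightNorm h₁
  have n₃ := FiniteMean.sum Finset.univ fun j => hJ.finiteMean_sqWeightNorm (h₂ j)
  have n₄ := (hW.bddSecondMoment_timeIntegral a t).conj_comp_neg.finiteMean_sqWeightNorm h₀
  -- Bounding the sum of all the squared noise norms gives one good event on which each of them is
  -- at most `r`.
  obtain ⟨r, hr⟩ := (((n₁.add n₂).add n₃).add n₄).exists_bound hη
  refine ⟨_, hr, unifLip_nlsStepOne hd Φ (fun j => hψ j t ht) t (r := r)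
    (ENNReal.coe_toNNReal h₀).ge ?_ ?_ ?_ ?_⟩ <;> intro ω hω
  · exact le_trans (le_self_add.trans (le_self_add.trans le_self_add)) hω
  · exact le_trans (le_add_self.trans (le_self_add.trans le_self_add)) hω
  · intro j
    refine le_trans (le_trans ?_ (le_add_self.trans le_self_add)) hω
    exact Finset.single_le_sum (f := fun j => sqWeightNorm fun n => Complex.I * (n j : ℂ) * Φ n *
      wienerIntegral (fun s => W n s ω) a t) (fun _ _ => zero_le) (Finset.mem_univ j)
  · exact le_trans le_add_self hω

theorem isStochasticallyStable_manakovScheme {Ω : Type*} [MeasurableSpace Ω] {P : Measure Ω}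
    {d : ℕ} (hd : d ≤ 3) {B : Fin 3 → ℝ≥0 → Ω → ℝ} (γ : ℝ) {ψ₁ ψ₂ : ℝ≥0 → Mode d → ℂ}
    (hB : ∀ j, IsBrownianReal (B j) P) (h₁ : IsFilter ψ₁) (h₂ : IsFilter ψ₂) :
    IsStochasticallyStable 2 P (manakovScheme γ ψ₁ ψ₂ B) := by
  refine isStochasticallyStable_of_unifLip hd hasFourierInversion_C2 fun t₀ t ht ℓ η hη => ?_
  obtain ⟨r, hr⟩ := (FiniteMean.sum Finset.univ fun j =>
    finiteMean_brownian_normIncr (hB j) (t₀ + ℓ * t) t).exists_bound hη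
  refine ⟨_, hr, unifLip_manakovStep hd γ (h₁ t ht) (h₂ t ht) t (r := r + 1) fun ω hω j => ?_⟩
  set χ := normIncr (fun s => B j s ω) (t₀ + ℓ * t) t
  have h : ‖χ‖ₑ ^ 2 ≤ r := le_trans (Finset.single_le_sum
    (f := fun j => ‖normIncr (fun s => B j s ω) (t₀ + ℓ * t) t‖ₑ ^ 2)
    (fun _ _ => zero_le) (Finset.mem_univ j)) hω
  rw [enorm_eq_nnnorm] at h
  have h' : ‖χ‖ ^ 2 ≤ (r : ℝ) := by exact_mod_cast h
  push_cast
  -- From `2x ≤ x² + 1 ≤ r + 1`; this is the reason for the bound `r + 1`.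
  nlinarith [sq_nonneg (‖χ‖ - 1)]

end

end LowRegScheme

open LowRegScheme

theorem mainTheorem7 {Ω : Type*} [MeasurableSpace Ω] (P : Measure Ω) [IsProbabilityMeasure P]
    (d : ℕ) (hd₁ : 1 ≤ d) (hd₃ : d ≤ 3) :
    (∀ (W : Mode d → ℝ≥0 → Ω → ℂ) (Φ : Mode d → ℂ) (θ : ℝ≥0 → ℝ), IsCylindricalWiener W P →
      Summable (fun n => ‖Φ n‖ ^ 2 * freqSq n ^ 2) →
      IsStochasticallyStable 2 P (nlsSchemeHalf Φ θ W)) ∧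
    (∀ (W : Mode d → ℝ≥0 → Ω → ℂ) (Φ : Mode d → ℂ) (ψ : Fin d → ℝ≥0 → Mode d → ℂ),
      IsCylindricalWiener W P →
      Summable (fun n => ‖Φ n‖ ^ 2 * freqSq n ^ 4) →
      (∀ j, IsFilter (ψ j)) →
      IsStochasticallyStable 2 P (nlsSchemeOne Φ ψ W)) ∧
    (∀ (B : Fin 3 → ℝ≥0 → Ω → ℝ) (γ : ℝ) (ψ₁ ψ₂ : ℝ≥0 → Mode d → ℂ),
      (∀ j, IsBrownianReal (B j) P) → iIndepFun (fun j ω t => B j t ω) P →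
      IsFilter ψ₁ → IsFilter ψ₂ →
      IsStochasticallyStable 2 P (manakovScheme γ ψ₁ ψ₂ B)) := by
  exact ⟨fun W Φ θ hW hΦ => isStochasticallyStable_nlsSchemeHalf hd₃ θ hW hΦ,
    fun W Φ ψ hW hΦ hψ => isStochasticallyStable_nlsSchemeOne hd₃ hW hΦ hψ,
    fun B γ ψ₁ ψ₂ hB _ h₁ h₂ => isStochasticallyStable_manakovScheme hd₃ γ hB h₁ h₂⟩
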